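/- Let $(X,\tau)$ be a complex locally convex space and let $\|\cdot\|$ be a norm on $X$. Let $\mathcal N$ be the set of all $\tau$-continuous seminorms $p$ on $X$ with $p(x)\le\|x\|$ for all $x\in X$. Suppose that $(X,\tau,\|\cdot\|)$ is of type B, that is: $(X,\tau)$ is sequentially complete; $\tau$ is weaker than the norm topology; both topologies have the same bounded sets; and $\mathcal N$ is countably convex, i.e. $\sum_n\alpha_np_n\in\mathcal N$ whenever $p_n\in\mathcal N$, $\alpha_n\ge 0$ and $\sum_n\alpha_n=1$. A strongly continuous semigroup on $X$ is a family $\{T(t)\}_{t\ge 0}$ of $\tau$-continuous linear operators with $T(0)=1$, $T(s+t)=T(s)T(t)$ and $t\mapsto T(t)x$ $\tau$-continuous for every $x\in X$. It is of type $(M,\omega)$ if for every $p\in\mathcal N$ and every $t_0\ge 0$ there is $q\in\mathcal N$ such that $\sup_{t\le t_0}e^{-\omega t}p(T(t)x)\le Mq(x)$ for all $x\in X$ (such a semigroup is in particular locally equi-continuous). Its generator is the operator $Ax=\lim_{t\downarrow 0}\frac{T(t)x-x}{t}$, whose domain consists of all $x\in X$ for which this limit exists in $(X,\tau)$. For a linear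 operator $(A,\mathcal D(A))$ on $X$, the resolvent set $\rho(A)$ consists of those $\lambda\in\mathbb C$ for which $\lambda-A:\mathcal D(A)\to X$ is bijective, and $R(\lambda)=(\lambda-A)^{-1}$ for $\lambda\in\rho(A)$. The operator $A$ is closed if its graph is closed in $X\times X$ for the product topology, and densely defined if $\mathcal D(A)$ is $\tau$-dense in $X$. **Theorem.** Let $M\ge 1$ and $\omega\in\mathbb R$. For a linear operator $(A,\mathcal D(A))$ on $X$, the following are equivalent. (a) $(A,\mathcal D(A))$ is the generator of a strongly continuous semigroup of type $(M,\omega)$. (b) $(A,\mathcal D(A))$ is closed and densely defined, every real $\lambda>\omega$ lies in $\rho(A)$, and for every $p\in\mathcal N$ and every real $\lambda_0>\omega$ there is $q\in\mathcal N$ such that for all $x\in X$ $$\sup_{n\ge 1}\ \sup_{\lambda\ge\lambda_0}\ p\Big(\big(n(\lambda-\omega)\,R(\omega+n(\lambda-\omega))\big)^nx\Big)\le M\,q(x).$$ (c) $(A,\mathcal D(A))$ is closed and densely defined, every $\lambda\in\mathbb C$ with $\operatorname{Re}\lambda>\omega$ lies in $\rho(A)$, and for every $p\in\mathcal N$ and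 every real $\lambda_0>\omega$ there is $q\in\mathcal N$ such that for all $x\in X$ $$\sup_{n\ge 1}\ \sup_{\operatorname{Re}\lambda\ge\lambda_0}\ p\Big(\big(n(\operatorname{Re}\lambda-\omega)\,R(\omega+n(\lambda-\omega))\big)^nx\Big)\le M\,q(x),$$ where the inner supremum is over complex $\lambda$. -/

import Mathlib

open Filter Topology
open scoped NNReal

namespace HilleYosida

variable {X : Type*} [AddCommGroup X] [Module ℂ X] [UniformSpace X]

/-- The set `𝒩` attached to `(X, τ, ‖·‖)`: the `τ`-continuous seminorms `p` with `p ≤ ‖·‖`.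
Here `τ` is the topology of `X`, and `nrm` is the auxiliary norm. -/
def dominatedSeminorms (nrm : Seminorm ℂ X) : Set (Seminorm ℂ X) :=
  {p | Continuous p ∧ p ≤ nrm}

/-- The locally convex space `X`, equipped with the auxiliary norm `nrm`, is of type B. -/
structure IsTypeB (nrm : Seminorm ℂ X) : Prop where
  /-- The seminorm `nrm` is a norm. -/
  definite : ∀ x, nrm x = 0 → x = 0
  /-- `(X, τ)` is sequentially complete. -/
  seqComplete : ∀ u : ℕ → X, CauchySeq u → ∃ x, Tendsto u atTop (𝓝 x)
  /-- `τ` is weaker than the norm topology. -/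
  weaker : ∀ U ∈ 𝓝 (0 : X), ∃ r > 0, nrm.ball 0 r ⊆ U
  /-- Both topologies have the same bounded sets. -/
  bounded_iff : ∀ S : Set X, Bornology.IsVonNBounded ℂ S ↔ ∃ C : ℝ, ∀ x ∈ S, nrm x ≤ C
  /-- `𝒩` is closed under countable convex combinations. -/
  countablyConvex : ∀ (p : ℕ → Seminorm ℂ X) (α : ℕ → ℝ),
    (∀ n, p n ∈ dominatedSeminorms nrm) → (∀ n, 0 ≤ α n) → HasSum α 1 →
    ∃ q ∈ dominatedSeminorms nrm, ∀ x, HasSum (fun n => α n * p n x) (q x)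

/-- A strongly continuous semigroup of continuous linear operators on `X`. -/
structure IsStronglyContinuousSemigroup (T : ℝ≥0 → X →L[ℂ] X) : Prop where
  zero : T 0 = ContinuousLinearMap.id ℂ X
  add : ∀ s t, T (s + t) = (T s).comp (T t)
  continuous : ∀ x, Continuous fun t => T t x

/-- `T` is of type `(M, ω)`: for all `p ∈ 𝒩` and `t₀ ≥ 0` there is `q ∈ 𝒩` with
`sup_{t ≤ t₀} e^{-ω t} p (T(t) x) ≤ M q(x)` for all `x`. -/
def IsOfType (nrm : Seminorm ℂ X) (T : ℝ≥0 → X →L[ℂ] X) (M ω : ℝ) : Prop :=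
  ∀ p ∈ dominatedSeminorms nrm, ∀ t₀ : ℝ≥0, ∃ q ∈ dominatedSeminorms nrm,
    ∀ x, ∀ t ≤ t₀, Real.exp (-ω * t) * p (T t x) ≤ M * q x

/-- The (partially defined) operator `A` is the generator of `T`: its graph consists of exactly
the pairs `(x, y)` such that `(T(t) x - x) / t` tends to `y` as `t ↓ 0`. -/
def IsGenerator (T : ℝ≥0 → X →L[ℂ] X) (A : X →ₗ.[ℂ] X) : Prop :=
  ∀ x y, (x, y) ∈ A.graph ↔
    Tendsto (fun t : ℝ≥0 => ((t : ℝ) : ℂ)⁻¹ • (T t x - x)) (𝓝[>] 0) (𝓝 y)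

/-- The map `l - A : 𝒟(A) → X`. -/
def subOp {X : Type*} [AddCommGroup X] [Module ℂ X] (A : X →ₗ.[ℂ] X) (l : ℂ) :
    A.domain →ₗ[ℂ] X :=
  l • A.domain.subtype - A.toFun

/-- The resolvent set: all `l` such that `l - A : 𝒟(A) → X` is bijective. -/
def opResolventSet {X : Type*} [AddCommGroup X] [Module ℂ X] (A : X →ₗ.[ℂ] X) : Set ℂ :=
  {l | Function.Bijective (subOp A l)}

open Classical in
/-- The resolvent `R(l) = (l - A)⁻¹ : X → 𝒟(A) ⊆ X`, for `l` in the resolvent set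
(with the unused value `0` for other `l`). -/
noncomputable def opResolvent {X : Type*} [AddCommGroup X] [Module ℂ X] (A : X →ₗ.[ℂ] X) (l : ℂ) :
    X →ₗ[ℂ] X :=
  if h : Function.Bijective (subOp A l) then
    A.domain.subtype ∘ₗ (LinearEquiv.ofBijective (subOp A l) h).symm.toLinearMap
  else 0

end HilleYosida

/-! Passing from (c) to (b) is restriction to real λ. The content lies in (b) → (a) and (a) → (c).

(b) → (a). With h = 1/(n(λ - ω)) the operator in the estimate is the implicit Euler step V_h = (1 -
h(A - ω))⁻¹, and (b) says that V_h^n is stable as long as nh ≤ 1/(λ₀ - ω). One step of size 2a and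
two steps of size a differ, on the domain of (A - ω)², by a²(A - ω)² up to stable factors
(`double_sub_sq`). Over a bounded time this sums to O(a), so halving the step repeatedly gives a
Cauchy sequence. Stability and density extend this to all vectors, and sequential completeness
supplies the limit S(t). Semigroup law, continuity and derivative at 0 are inherited from the
discrete scheme, and T(t) = e^{ωt}S(t). The generator of T extends A; it equals A because l - A is
surjective and l minus the generator is injective.

(a) → (c). R(λ)x is the weak integral of e^{-λt}T(t)x. Hence (Re λ - ω)R(λ) is controlled by
averaging e^{-ωt}T(t) over an exponential time of mean 1/(Re λ - ω), and the n-th power at ω + n(λ -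
ω) by averaging over a Gamma time of the same mean, at most τ = 1/(λ₀ - ω). Averaging an affine
function evaluates it at the mean, so it suffices to have e^{-ωt}p(T(t)x) ≤ a + bt for all t with a
+ bτ ≤ Mq(x). The seminorms provided by type (M, ω) depend on the time horizon; countable convexity
combines them into one q for which such a majorant exists (`exists_affine_majorant`). This keeps the
constant M. -/

namespace HilleYosida

/-! ### The topology of a type B space through its dominated seminorms. -/

section Topology

open scoped ComplexOrder in
theorem polynormableSpace_of_locallyConvexSpace (𝕜 X : Type*) [RCLike 𝕜] [AddCommGroup X]
    [Module 𝕜 X] [Module ℝ X] [IsScalarTower ℝ 𝕜 X] [TopologicalSpace X] [IsTopologicalAddGroup X]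
    [ContinuousSMul 𝕜 X] [ContinuousSMul ℝ X] [LocallyConvexSpace ℝ X] :
    PolynormableSpace 𝕜 X := by
  have : LocallyConvexSpace 𝕜 X := by
    rw [locallyConvexSpace_iff_exists_convex_subset_zero]
    intro U hU
    obtain ⟨S, hS, hc, hSU⟩ := (locallyConvexSpace_iff_exists_convex_subset_zero ℝ X).1 ‹_› U hU
    exact ⟨S, hS, convex_of_nonneg_surjective_algebraMap _
        (fun _ => RCLike.nonneg_iff_exists_ofReal.mp) hc, hSU⟩
  infer_instance

/-- A vector is normed by a functional dominated by a given seminorm. -/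
theorem exists_dual_eq_seminorm {X : Type*} [AddCommGroup X] [Module ℂ X] (p : Seminorm ℂ X)
    (x : X) : ∃ g : X →ₗ[ℂ] ℂ, (∀ y, ‖g y‖ ≤ p y) ∧ g x = p x := by
  let : SeminormedAddCommGroup X := AddGroupSeminorm.toSeminormedAddCommGroup
    p.toAddGroupSeminorm
  let : NormedSpace ℂ X := ⟨fun a b => (map_smul_eq_mul p a b).le⟩
  obtain ⟨g, hg, hgx⟩ := exists_dual_vector'' ℂ x
  exact ⟨g.toLinearMap, fun y => (g.le_of_opNorm_le hg y).trans (one_mul ‖y‖).le, hgx⟩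

variable {X : Type*} [AddCommGroup X] [Module ℂ X] [UniformSpace X]
  [IsUniformAddGroup X] [ContinuousSMul ℂ X] [LocallyConvexSpace ℝ X]
  {nrm : Seminorm ℂ X}

/-- A vector is normed by a functional dominated by a given continuous seminorm. -/
theorem exists_functional_eq_seminorm (p : Seminorm ℂ X) (hp : Continuous p) (x : X) :
    ∃ f : X →L[ℂ] ℂ, f x = p x ∧ ∀ y, ‖f y‖ ≤ p y := by
  have : ContinuousSMul ℝ X := IsScalarTower.continuousSMul ℂ
  have := polynormableSpace_of_locallyConvexSpace ℂ X
  obtain ⟨g, hg, hgx⟩ := exists_dual_eq_seminorm p x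
  have hgc : Continuous g := (PolynormableSpace.withSeminorms ℂ X).continuous_normedSpace_rng ℂ g
    ⟨{⟨p, hp⟩}, 1, fun y => by simpa using hg y⟩
  exact ⟨⟨g, hgc⟩, hgx, hg⟩

omit [IsUniformAddGroup X] [ContinuousSMul ℂ X] [LocallyConvexSpace ℝ X] in
-- Since τ is weaker than the norm topology, p is bounded by a multiple of the norm, and rescaling
-- makes it dominated. This is how statements about `dominatedSeminorms` reach all continuous
-- seminorms.
theorem IsTypeB.exists_smul_mem (hX : IsTypeB nrm) (p : Seminorm ℂ X) (hp : Continuous p) :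
    ∃ c : ℝ≥0, 0 < c ∧ c • p ∈ dominatedSeminorms nrm := by
  obtain ⟨r, hr, hsub⟩ := hX.weaker _ (Seminorm.ball_mem_nhds hp one_pos)
  refine ⟨⟨r / 2, by positivity⟩, by exact_mod_cast half_pos hr, ?_, ?_⟩
  · exact hp.const_smul (⟨r / 2, by positivity⟩ : ℝ≥0)
  · intro x
    change r / 2 * p x ≤ nrm x
    refine le_of_forall_pos_le_add fun ε hε => ?_
    have hd : 0 < nrm x + ε := add_pos_of_nonneg_of_pos (apply_nonneg nrm x) hε
    set d := nrm x + ε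
    have h1 : ((r / d : ℝ) : ℂ) • x ∈ nrm.ball 0 r := by
      rw [Seminorm.mem_ball_zero, map_smul_eq_mul, Complex.norm_real, Real.norm_of_nonneg
        (by positivity), div_mul_eq_mul_div, div_lt_iff₀ hd]
      exact mul_lt_mul_of_pos_left (lt_add_of_pos_right _ hε) hr
    have h2 := hsub h1
    rw [Seminorm.mem_ball_zero, map_smul_eq_mul, Complex.norm_real, Real.norm_of_nonneg
        (by positivity), div_mul_eq_mul_div, div_lt_iff₀ hd] at h2
    have := apply_nonneg p x
    nlinarith

theorem IsTypeB.exists_ball_subset (hX : IsTypeB nrm) {U : Set X} (hU : U ∈ 𝓝 (0 : X)) :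
    ∃ p ∈ dominatedSeminorms nrm, ∃ r > 0, ∀ x, p x < r → x ∈ U := by
  have : ContinuousSMul ℝ X := IsScalarTower.continuousSMul ℂ
  have := polynormableSpace_of_locallyConvexSpace ℂ X
  obtain ⟨s, r, hr, hsub⟩ := ((PolynormableSpace.withSeminorms ℂ X).mem_nhds_iff _ _).1 hU
  obtain ⟨c, hc, hp⟩ := hX.exists_smul_mem (s.sup fun p => p.1)
    (Seminorm.continuous_finsetSup fun i _ => i.2)
  refine ⟨_, hp, c * r, mul_pos (by exact_mod_cast hc) hr, fun x hx => hsub ?_⟩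
  rw [Seminorm.mem_ball_zero]
  exact lt_of_mul_lt_mul_left hx c.2

theorem IsTypeB.tendsto_zero_iff (hX : IsTypeB nrm) {ι : Type*} {l : Filter ι} {u : ι → X} :
    Tendsto u l (𝓝 0) ↔ ∀ p ∈ dominatedSeminorms nrm, Tendsto (fun i => p (u i)) l (𝓝 0) := by
  refine ⟨fun h p hp => ?_, fun h U hU => ?_⟩
  · simpa [Function.comp_def] using (hp.1.tendsto 0).comp h
  · obtain ⟨p, hp, r, hr, hsub⟩ := hX.exists_ball_subset hU
    filter_upwards [(h p hp).eventually_lt_const hr] with i hi using hsub _ hi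

theorem IsTypeB.tendsto_iff (hX : IsTypeB nrm) {ι : Type*} {l : Filter ι} {u : ι → X} {a : X} :
    Tendsto u l (𝓝 a) ↔
      ∀ p ∈ dominatedSeminorms nrm, Tendsto (fun i => p (u i - a)) l (𝓝 0) := by
  rw [← tendsto_sub_nhds_zero_iff, hX.tendsto_zero_iff]

theorem IsTypeB.cauchySeq (hX : IsTypeB nrm) {u : ℕ → X}
    (h : ∀ p ∈ dominatedSeminorms nrm, ∀ ε > 0, ∃ n₀, ∀ m ≥ n₀, ∀ n ≥ n₀, p (u m - u n) < ε) :
    CauchySeq u := by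
  rw [cauchySeq_iff]
  intro V hV
  rw [uniformity_eq_comap_nhds_zero X, mem_comap] at hV
  obtain ⟨U, hU, hUV⟩ := hV
  obtain ⟨p, hp, r, hr, hsub⟩ := hX.exists_ball_subset hU
  obtain ⟨n₀, hn⟩ := h p hp r hr
  exact ⟨n₀, fun m hm n hn' => hUV (hsub _ (hn n hn' m hm))⟩

/-- Separation comes from the bounded sets: if all p vanish at x, the multiples n • x form a
τ-bounded set, hence a norm-bounded one, which forces the norm of x to be 0. -/
theorem IsTypeB.eq_zero (hX : IsTypeB nrm) {x : X}
    (h : ∀ p ∈ dominatedSeminorms nrm, p x = 0) : x = 0 := by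
  have hb : Bornology.IsVonNBounded ℂ (Set.range fun n : ℕ => (n : ℂ) • x) := by
    intro U hU
    obtain ⟨p, hp, r, hr, hsub⟩ := hX.exists_ball_subset hU
    refine Absorbs.of_norm ⟨1, fun c hc => ?_⟩
    rintro _ ⟨n, rfl⟩
    have hc0 : c ≠ 0 := norm_pos_iff.1 (zero_lt_one.trans_le hc)
    refine ⟨c⁻¹ • (n : ℂ) • x, hsub _ ?_, smul_inv_smul₀ hc0 _⟩
    simp [map_smul_eq_mul, h p hp, hr]
  obtain ⟨C, hC⟩ := (hX.bounded_iff _).1 hb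
  refine hX.definite x (le_antisymm (le_of_forall_pos_le_add fun ε hε => ?_) (apply_nonneg nrm x))
  obtain ⟨n, hn⟩ := exists_nat_gt (C / ε)
  have h1 := hC _ ⟨n, rfl⟩
  simp only [map_smul_eq_mul, Complex.norm_natCast] at h1
  by_contra! h2
  rw [div_lt_iff₀ hε] at hn
  have : (n : ℝ) * ε ≤ n * nrm x := by gcongr; linarith
  linarith

theorem IsTypeB.t2Space (hX : IsTypeB nrm) : T2Space X := by
  have : T1Space X := by
    refine IsTopologicalAddGroup.t1Space _ ?_
    rw [← closure_eq_iff_isClosed]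
    refine subset_antisymm (fun x hx => hX.eq_zero fun p hp => ?_) subset_closure
    have hc : IsClosed {y | p y = 0} := isClosed_eq hp.1 continuous_const
    exact closure_minimal (by simp) hc hx
  infer_instance

/-- A linear map whose composites with dominated seminorms are dominated is continuous. -/
theorem IsTypeB.continuous_of_bound (hX : IsTypeB nrm) (L : X →ₗ[ℂ] X) (C : ℝ)
    (h : ∀ p ∈ dominatedSeminorms nrm, ∃ q ∈ dominatedSeminorms nrm, ∀ x, p (L x) ≤ C * q x) :
    Continuous L := by
  refine continuous_of_continuousAt_zero L ?_
  rw [ContinuousAt, map_zero, hX.tendsto_zero_iff]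
  intro p hp
  obtain ⟨q, hq, hpq⟩ := h p hp
  refine squeeze_zero (fun x => apply_nonneg p _) hpq ?_
  have : Tendsto (fun x => C * q x) (𝓝 0) (𝓝 (C * q 0)) := (hq.1.tendsto 0).const_mul C
  simpa using this

omit [IsUniformAddGroup X] [ContinuousSMul ℂ X] [LocallyConvexSpace ℝ X] in
theorem sup_mem_dominatedSeminorms {p q : Seminorm ℂ X} (hp : p ∈ dominatedSeminorms nrm)
    (hq : q ∈ dominatedSeminorms nrm) : p ⊔ q ∈ dominatedSeminorms nrm :=
  ⟨hp.1.sup hq.1, sup_le hp.2 hq.2⟩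

end Topology

/-! ### Algebra and consistency estimates of implicit Euler steps. -/

section ImplicitEuler

/-- The family `V h = (1 - h G)⁻¹`, `h > 0`, of the implicit Euler steps of the linear relation
`G`. -/
structure IsEulerFamily {X : Type*} [AddCommGroup X] [Module ℂ X] (G : Submodule ℂ (X × X))
    (V : ℝ → Module.End ℂ X) : Prop where
  mem_graph : ∀ h > 0, ∀ x, (V h x, (h : ℂ)⁻¹ • (V h x - x)) ∈ G
  apply_sub : ∀ h > 0, ∀ x y, (x, y) ∈ G → V h (x - (h : ℂ) • y) = x

/-- Stability of the family `V` of Euler steps, locally uniformly in time. -/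
def IsStable {X : Type*} [AddCommGroup X] [Module ℂ X] [UniformSpace X] (nrm : Seminorm ℂ X)
    (M : ℝ) (V : ℝ → Module.End ℂ X) : Prop :=
  ∀ p ∈ dominatedSeminorms nrm, ∀ t₀ : ℝ, ∃ q ∈ dominatedSeminorms nrm,
    ∀ h > 0, ∀ n : ℕ, n * h ≤ t₀ → ∀ x, p ((V h ^ n) x) ≤ M * q x

namespace IsEulerFamily

section Algebra

variable {X : Type*} [AddCommGroup X] [Module ℂ X] {G : Submodule ℂ (X × X)}
  {V : ℝ → Module.End ℂ X} (hV : IsEulerFamily G V)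
include hV

theorem apply_sub_self {h : ℝ} (hh : 0 < h) {x y : X} (hxy : (x, y) ∈ G) :
    V h x - x = (h : ℂ) • V h y := by
  have := hV.apply_sub h hh x y hxy
  rw [map_sub, map_smul] at this
  rw [sub_eq_iff_eq_add, ← sub_eq_iff_eq_add']
  exact this

theorem map_mem {h : ℝ} (hh : 0 < h) {x y : X} (hxy : (x, y) ∈ G) : (V h x, V h y) ∈ G := by
  have := hV.mem_graph h hh x
  rwa [hV.apply_sub_self hh hxy, inv_smul_smul₀ (by exact_mod_cast hh.ne')] at this

theorem pow_mem {h : ℝ} (hh : 0 < h) {x y : X} (hxy : (x, y) ∈ G) (n : ℕ) :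
    ((V h ^ n) x, (V h ^ n) y) ∈ G := by
  induction n with
  | zero => simpa using hxy
  | succ n ih => simpa only [pow_succ', Module.End.mul_apply] using hV.map_mem hh ih

/-- V_h preserves G, so it carries the pair of V_k x to a pair whose image under 1 - kG is V_h x;
applying V_k recovers V_h V_k x. -/
theorem commute {h k : ℝ} (hh : 0 < h) (hk : 0 < k) : Commute (V h) (V k) := by
  refine LinearMap.ext fun x => ?_
  have h1 := hV.map_mem hh (hV.mem_graph k hk x)
  have h2 := hV.apply_sub k hk _ _ h1
  rw [map_smul, smul_inv_smul₀ (by exact_mod_cast hk.ne'), ← map_sub (V h), sub_sub_cancel] at h2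
  exact h2.symm

/-- Each step moves the orbit of x by h times a stable iterate of y; the increments telescope. -/
theorem pow_sub_pow_le {p q : Seminorm ℂ X} {M t₀ h : ℝ} (hh : 0 < h)
    (hb : ∀ n : ℕ, n * h ≤ t₀ → ∀ x, p ((V h ^ n) x) ≤ M * q x) {x y : X} (hxy : (x, y) ∈ G)
    {m n : ℕ} (hmn : m ≤ n) (hn : n * h ≤ t₀) :
    p ((V h ^ n) x - (V h ^ m) x) ≤ (n - m) * h * (M * q y) := by
  induction n, hmn using Nat.le_induction with
  | base => simp
  | succ n hmn ih =>
    have hn' : n * h ≤ t₀ := le_trans (by gcongr; simp) hn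
    have h1 : (V h ^ (n + 1)) x - (V h ^ m) x =
        (h : ℂ) • (V h ^ (n + 1)) y + ((V h ^ n) x - (V h ^ m) x) := by
      rw [pow_succ', Module.End.mul_apply, Module.End.mul_apply,
        ← hV.apply_sub_self hh (hV.pow_mem hh hxy n)]
      abel
    rw [h1]
    refine (map_add_le_add p _ _).trans ?_
    rw [map_smul_eq_mul, Complex.norm_real, Real.norm_of_nonneg hh.le]
    have h2 := mul_le_mul_of_nonneg_left (hb _ hn y) hh.le
    have h3 := ih hn'
    push_cast
    linarith

/-- A resolvent identity: the inverses of V(2a) and V(a)² are 1 - 2aG and (1 - aG)² = 1 - 2aG +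
a²G², which differ only by a²G². -/
theorem double_sub_sq {a : ℝ} (ha : 0 < a) {x y z : X} (hxy : (x, y) ∈ G) (hyz : (y, z) ∈ G) :
    V (2 * a) x - (V a ^ 2) x = ((a : ℂ) ^ 2) • V (2 * a) ((V a ^ 2) z) := by
  set U := V (2 * a)
  set W := V a ^ 2
  have hc : Commute U W := (hV.commute (by positivity) ha).pow_right 2
  have hU : U (x - ((2 * a : ℝ) : ℂ) • y) = x := hV.apply_sub _ (by positivity) _ _ hxy
  have hW : W (x - ((2 * a : ℝ) : ℂ) • y + ((a : ℂ) ^ 2) • z) = x := by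
    have h1 : x - ((2 * a : ℝ) : ℂ) • y + ((a : ℂ) ^ 2) • z =
        (x - (a : ℂ) • y) - (a : ℂ) • (y - (a : ℂ) • z) := by
      push_cast
      module
    have h2 : (x - (a : ℂ) • y, y - (a : ℂ) • z) ∈ G := G.sub_mem hxy (G.smul_mem _ hyz)
    rw [h1]
    simp only [W, pow_two, Module.End.mul_apply]
    rw [hV.apply_sub a ha _ _ h2, hV.apply_sub a ha _ _ hxy]
  have h3 : U x = W x + ((a : ℂ) ^ 2) • U (W z) := by
    have h4 : W (U (x - ((2 * a : ℝ) : ℂ) • y)) + ((a : ℂ) ^ 2) • U (W z) = U x := by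
      conv_rhs => rw [← hW]
      rw [map_add W, map_smul W, map_add U, map_smul U]
      congr 1
      exact (LinearMap.congr_fun hc _).symm
    rw [← h4, hU]
  rw [h3]
  abel

/-- For commuting U = V(2a) and W = V(a)², write Uⁿ - Wⁿ as the geometric sum of UⁱWⁿ⁻¹⁻ⁱ(U - W).
Each term contains powers of two different steps, so stability is used twice, from p to q and from q
to r. -/
theorem double_pow_sub_pow_le {p q r : Seminorm ℂ X} {M t₀ : ℝ} (hM : 0 ≤ M)
    (hb : ∀ h > 0, ∀ n : ℕ, n * h ≤ t₀ → ∀ x, p ((V h ^ n) x) ≤ M * q x)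
    (hb' : ∀ h > 0, ∀ n : ℕ, n * h ≤ t₀ → ∀ x, q ((V h ^ n) x) ≤ M * r x)
    {x y z : X} (hxy : (x, y) ∈ G) (hyz : (y, z) ∈ G) {a : ℝ} (ha : 0 < a) {n : ℕ}
    (hn : n * (2 * a) ≤ t₀) :
    p ((V (2 * a) ^ n) x - (V a ^ (2 * n)) x) ≤ n * (a ^ 2 * (M * (M * r z))) := by
  have ha2 : 0 < 2 * a := by positivity
  have hc : Commute (V (2 * a)) (V a ^ 2) := (hV.commute ha2 ha).pow_right 2
  have h1 : (V (2 * a) ^ n) x - (V a ^ (2 * n)) x = ∑ i ∈ Finset.range n,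
      ((a : ℂ) ^ 2) • (V (2 * a) ^ (i + 1)) ((V a ^ (2 * (n - i))) z) := by
    rw [pow_mul, ← LinearMap.sub_apply, ← hc.geom_sum₂_mul, Module.End.mul_apply,
      LinearMap.sub_apply, hV.double_sub_sq ha hxy hyz, LinearMap.sum_apply]
    refine Finset.sum_congr rfl fun i hi => ?_
    have hi' : n - i = (n - 1 - i) + 1 := by have := Finset.mem_range.1 hi; omega
    rw [map_smul, pow_mul, hi', pow_succ (V (2 * a)), pow_succ (V a ^ 2)]
    congr 1
    simp only [← Module.End.mul_apply]
    refine LinearMap.congr_fun ?_ z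
    simp only [mul_assoc]
    rw [← mul_assoc _ (V (2 * a)), ((hc.symm.pow_left (n - 1 - i))).eq, mul_assoc]
  rw [h1]
  refine (Finset.le_sum_of_subadditive p (map_zero p).le (map_add_le_add p) _ _).trans ?_
  calc ∑ i ∈ Finset.range n, p (((a : ℂ) ^ 2) •
          (V (2 * a) ^ (i + 1)) ((V a ^ (2 * (n - i))) z))
      ≤ ∑ i ∈ Finset.range n, a ^ 2 * (M * (M * r z)) := by
        refine Finset.sum_le_sum fun i hi => ?_
        have hi' : i + 1 ≤ n := Finset.mem_range.1 hi
        rw [map_smul_eq_mul, norm_pow, Complex.norm_real, Real.norm_of_nonneg ha.le]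
        have hi1 : ((i + 1 : ℕ) : ℝ) * (2 * a) ≤ t₀ :=
          le_trans (by gcongr) hn
        have hi2 : ((2 * (n - i) : ℕ) : ℝ) * a ≤ t₀ := by
          refine le_trans ?_ hn
          have : ((2 * (n - i) : ℕ) : ℝ) ≤ 2 * n := by
            exact_mod_cast Nat.mul_le_mul_left 2 (Nat.sub_le n i)
          nlinarith
        gcongr
        exact (hb _ ha2 _ hi1 _).trans (by gcongr; exact hb' _ ha _ hi2 _)
    _ = n * (a ^ 2 * (M * (M * r z))) := by simp

end Algebra

end IsEulerFamily

end ImplicitEuler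

/-! ### Convergence of the dyadic Euler approximations. -/

section EulerLimit

variable {X : Type*} [AddCommGroup X] [Module ℂ X] [UniformSpace X]
  {nrm : Seminorm ℂ X}

theorem exists_seminorm_sub_lt_of_dense [IsUniformAddGroup X] {D : Set X} (hD : Dense D)
    (q : Seminorm ℂ X) (hq : Continuous q) (x : X) {ε : ℝ} (hε : 0 < ε) :
    ∃ z ∈ D, q (x - z) < ε := by
  have h : IsOpen {z | q (x - z) < ε} :=
    isOpen_lt (hq.comp (continuous_const.sub continuous_id)) continuous_const
  obtain ⟨z, hz, hzD⟩ := hD.inter_open_nonempty _ h ⟨x, by simpa using hε⟩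
  exact ⟨z, hzD, hz⟩

/-- The Euler approximation at time `t` with step size `2⁻ʲ`. -/
noncomputable def eulerApprox (V : ℝ → Module.End ℂ X) (t : ℝ≥0) (j : ℕ) : Module.End ℂ X :=
  V ((1 / 2) ^ j) ^ ⌊t * (2 : ℝ≥0) ^ j⌋₊

theorem half_pow_pos (j : ℕ) : (0 : ℝ) < (1 / 2) ^ j := by positivity

theorem floor_mul_half_pow_le (t : ℝ≥0) (j : ℕ) :
    (⌊t * (2 : ℝ≥0) ^ j⌋₊ : ℝ) * (1 / 2) ^ j ≤ t := by
  have h : ((⌊t * (2 : ℝ≥0) ^ j⌋₊ : ℝ≥0) : ℝ) ≤ ((t * (2 : ℝ≥0) ^ j : ℝ≥0) : ℝ) :=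
    NNReal.coe_le_coe.2 (Nat.floor_le zero_le)
  push_cast at h
  calc (⌊t * (2 : ℝ≥0) ^ j⌋₊ : ℝ) * (1 / 2) ^ j ≤ (t * 2 ^ j) * (1 / 2) ^ j := by gcongr
    _ = t := by rw [mul_assoc, ← mul_pow]; norm_num

theorem lt_floor_add_one_mul_half_pow (t : ℝ≥0) (j : ℕ) :
    (t : ℝ) < ((⌊t * (2 : ℝ≥0) ^ j⌋₊ : ℝ) + 1) * (1 / 2) ^ j := by
  have h : ((t * (2 : ℝ≥0) ^ j : ℝ≥0) : ℝ) < ((⌊t * (2 : ℝ≥0) ^ j⌋₊ + 1 : ℝ≥0) : ℝ) :=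
    NNReal.coe_lt_coe.2 (Nat.lt_floor_add_one _)
  push_cast at h
  calc (t : ℝ) = (t * 2 ^ j) * (1 / 2) ^ j := by rw [mul_assoc, ← mul_pow]; norm_num
    _ < _ := by gcongr

theorem floor_two_mul (y : ℝ≥0) : ⌊y * 2⌋₊ = 2 * ⌊y⌋₊ ∨ ⌊y * 2⌋₊ = 2 * ⌊y⌋₊ + 1 := by
  have h1 : 2 * ⌊y⌋₊ ≤ ⌊y * 2⌋₊ := by
    rw [Nat.le_floor_iff zero_le, mul_comm y]
    push_cast
    gcongr
    exact Nat.floor_le zero_le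
  have h2 : ⌊y * 2⌋₊ < 2 * ⌊y⌋₊ + 2 := by
    rw [Nat.floor_lt zero_le]
    push_cast
    have := Nat.lt_floor_add_one y
    calc y * 2 < (⌊y⌋₊ + 1) * 2 := by gcongr
      _ = _ := by ring
  omega

theorem floor_add_eq (y z : ℝ≥0) :
    ⌊y + z⌋₊ = ⌊y⌋₊ + ⌊z⌋₊ ∨ ⌊y + z⌋₊ = ⌊y⌋₊ + ⌊z⌋₊ + 1 := by
  have h1 : ⌊y⌋₊ + ⌊z⌋₊ ≤ ⌊y + z⌋₊ := by
    rw [Nat.le_floor_iff zero_le]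
    push_cast
    exact add_le_add (Nat.floor_le zero_le) (Nat.floor_le zero_le)
  have h2 : ⌊y + z⌋₊ < ⌊y⌋₊ + ⌊z⌋₊ + 2 := by
    rw [Nat.floor_lt zero_le]
    push_cast
    calc y + z < (⌊y⌋₊ + 1) + (⌊z⌋₊ + 1) :=
          add_lt_add (Nat.lt_floor_add_one y) (Nat.lt_floor_add_one z)
      _ = _ := by ring
  omega

theorem IsStable.eulerApprox_le {M : ℝ} {V : ℝ → Module.End ℂ X} (hS : IsStable nrm M V)
    {p : Seminorm ℂ X} (hp : p ∈ dominatedSeminorms nrm) (t₀ : ℝ≥0) :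
    ∃ q ∈ dominatedSeminorms nrm, ∀ t ≤ t₀, ∀ j x, p (eulerApprox V t j x) ≤ M * q x := by
  obtain ⟨q, hq, hb⟩ := hS p hp t₀
  exact ⟨q, hq, fun t ht j x => hb _ (half_pow_pos j) _
    ((floor_mul_half_pow_le t j).trans (by exact_mod_cast ht)) x⟩

namespace IsEulerFamily

variable [IsUniformAddGroup X] [ContinuousSMul ℂ X] [LocallyConvexSpace ℝ X]
  {G : Submodule ℂ (X × X)} {V : ℝ → Module.End ℂ X} {M : ℝ}

omit [IsUniformAddGroup X] [ContinuousSMul ℂ X] [LocallyConvexSpace ℝ X] in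
theorem tendsto_apply_sub (hV : IsEulerFamily G V) (hS : IsStable nrm M V)
    {p : Seminorm ℂ X} (hp : p ∈ dominatedSeminorms nrm) {x y : X} (hxy : (x, y) ∈ G) :
    Tendsto (fun h => p (V h x - x)) (𝓝[>] 0) (𝓝 0) := by
  obtain ⟨q, hq, hb⟩ := hS p hp 1
  have h1 : Tendsto (fun h : ℝ => h * (M * q y)) (𝓝[>] 0) (𝓝 0) := by
    have : Tendsto (fun h : ℝ => h * (M * q y)) (𝓝 0) (𝓝 (0 * (M * q y))) :=
      tendsto_id.mul_const _
    rw [zero_mul] at this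
    exact this.mono_left nhdsWithin_le_nhds
  refine squeeze_zero' (Eventually.of_forall fun _ => apply_nonneg p _) ?_ h1
  filter_upwards [Ioc_mem_nhdsGT (one_pos (α := ℝ))] with h hh
  rw [hV.apply_sub_self hh.1 hxy, map_smul_eq_mul, Complex.norm_real, Real.norm_of_nonneg hh.1.le]
  have := hb h hh.1 1 (by simpa using hh.2) y
  rw [pow_one] at this
  exact mul_le_mul_of_nonneg_left this hh.1.le

omit [ContinuousSMul ℂ X] [LocallyConvexSpace ℝ X] in
-- V_h maps the domain of G into that of G² and moves vectors of the domain little for small h, so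
-- density of the first domain gives approximation by the second.
theorem dense_sq (hV : IsEulerFamily G V) (hS : IsStable nrm M V)
    (hD : Dense {x | ∃ y, (x, y) ∈ G}) {p : Seminorm ℂ X} (hp : p ∈ dominatedSeminorms nrm)
    (x : X) {ε : ℝ} (hε : 0 < ε) :
    ∃ x' y z, (x', y) ∈ G ∧ (y, z) ∈ G ∧ p (x - x') < ε := by
  obtain ⟨z, ⟨w, hzw⟩, hz⟩ := exists_seminorm_sub_lt_of_dense hD p hp.1 x (half_pos hε)
  obtain ⟨h, hlt, hh⟩ := (((hV.tendsto_apply_sub hS hp hzw).eventually_lt_const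
    (half_pos hε)).and self_mem_nhdsWithin).exists
  refine ⟨V h z, V h w, _, hV.map_mem hh hzw, hV.mem_graph h hh w, ?_⟩
  have h1 : x - V h z = (x - z) - (V h z - z) := by abel
  rw [h1]
  exact (map_sub_le_add p _ _).trans_lt (by linarith)

omit [IsUniformAddGroup X] [ContinuousSMul ℂ X] [LocallyConvexSpace ℝ X] in
-- Two errors arise on halving the step: rounding t may add one extra step, which costs a single
-- increment, and the remaining 2n half steps replace n full ones.
theorem eulerApprox_succ_sub_le (hV : IsEulerFamily G V) (hS : IsStable nrm M V) (hM : 0 ≤ M)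
    {p : Seminorm ℂ X} (hp : p ∈ dominatedSeminorms nrm) (t : ℝ≥0) {x y z : X}
    (hxy : (x, y) ∈ G) (hyz : (y, z) ∈ G) :
    ∃ C : ℝ, 0 ≤ C ∧
      ∀ j, p (eulerApprox V t (j + 1) x - eulerApprox V t j x) ≤ C * (1 / 2) ^ j := by
  obtain ⟨q, hq, hb⟩ := hS p hp t
  obtain ⟨r, hr, hb'⟩ := hS q hq t
  have hqy : 0 ≤ M * q y := mul_nonneg hM (apply_nonneg q y)
  have hrz : 0 ≤ M * (M * r z) := mul_nonneg hM (mul_nonneg hM (apply_nonneg r z))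
  refine ⟨M * q y + t * (M * (M * r z)), by positivity, fun j => ?_⟩
  set n := ⌊t * (2 : ℝ≥0) ^ j⌋₊ with hn
  set a : ℝ := (1 / 2) ^ (j + 1) with ha
  have ha0 : 0 < a := half_pow_pos _
  have h2a : (1 / 2 : ℝ) ^ j = 2 * a := by rw [ha, pow_succ]; ring
  have hnt : n * (2 * a) ≤ t := by rw [← h2a]; exact floor_mul_half_pow_le t j
  set m := ⌊t * (2 : ℝ≥0) ^ (j + 1)⌋₊ with hm
  have hmt : m * a ≤ t := floor_mul_half_pow_le t (j + 1)
  have hmn : m = 2 * n ∨ m = 2 * n + 1 := by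
    rw [hm, pow_succ, ← mul_assoc]
    exact floor_two_mul _
  have h1 : p ((V (2 * a) ^ n) x - (V a ^ (2 * n)) x) ≤ n * (a ^ 2 * (M * (M * r z))) :=
    hV.double_pow_sub_pow_le hM hb hb' hxy hyz ha0 hnt
  have h2 : p ((V a ^ m) x - (V a ^ (2 * n)) x) ≤ (m - (2 * n : ℕ)) * a * (M * q y) :=
    hV.pow_sub_pow_le ha0 (hb a ha0) hxy (by omega) hmt
  have h3 : (m : ℝ) - (2 * n : ℕ) ≤ 1 := by
    rcases hmn with h | h <;> rw [h] <;> push_cast <;> linarith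
  have h4 : eulerApprox V t (j + 1) x - eulerApprox V t j x =
      ((V a ^ m) x - (V a ^ (2 * n)) x) - ((V (2 * a) ^ n) x - (V a ^ (2 * n)) x) := by
    simp only [eulerApprox]
    rw [h2a]
    abel
  rw [h4, h2a]
  refine (map_sub_le_add p _ _).trans ((add_le_add h2 h1).trans ?_)
  have h5 : ((m : ℝ) - (2 * n : ℕ)) * a * (M * q y) ≤ 1 * a * (M * q y) := by gcongr
  have h6 : n * (a ^ 2 * (M * (M * r z))) = (n * (2 * a)) * (a / 2 * (M * (M * r z))) := by ring
  have h7 : (n * (2 * a)) * (a / 2 * (M * (M * r z))) ≤ t * (a / 2 * (M * (M * r z))) := by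
    gcongr
  have h8 : 0 ≤ a * (M * q y) := by positivity
  have h9 : 0 ≤ t * (a * (M * (M * r z))) := by positivity
  rw [h6]
  linarith

theorem exists_tendsto_eulerApprox (hX : IsTypeB nrm) (hV : IsEulerFamily G V)
    (hS : IsStable nrm M V) (hM : 0 ≤ M) (hD : Dense {x | ∃ y, (x, y) ∈ G}) (t : ℝ≥0) (x : X) :
    ∃ y, Tendsto (fun j => eulerApprox V t j x) atTop (𝓝 y) := by
  refine hX.seqComplete _ (hX.cauchySeq fun p hp ε hε => ?_)
  obtain ⟨q, hq, hb⟩ := hS.eulerApprox_le hp t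
  have hM1 : 0 < M + 1 := by linarith
  obtain ⟨x', y, z, hxy, hyz, hx'⟩ := hV.dense_sq hS hD hq x
    (ε := ε / (4 * (M + 1))) (by positivity)
  obtain ⟨C, hC, hstep⟩ := hV.eulerApprox_succ_sub_le hS hM hp t hxy hyz
  have htel : ∀ n k, p (eulerApprox V t (n + k) x' - eulerApprox V t n x') ≤
      C * 2 * ((1 / 2) ^ n - (1 / 2) ^ (n + k)) := by
    intro n k
    induction k with
    | zero => simp
    | succ k ih =>
      have h1 := hstep (n + k)
      have h2 := le_map_add_map_sub p (eulerApprox V t (n + (k + 1)) x' - eulerApprox V t n x')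
        (eulerApprox V t (n + k) x' - eulerApprox V t n x')
      rw [sub_sub_sub_cancel_right] at h2
      rw [← add_assoc] at h2 ⊢
      rw [pow_succ (1 / 2 : ℝ) (n + k)]
      linarith
  have htel' : ∀ n₀ m, n₀ ≤ m → p (eulerApprox V t m x' - eulerApprox V t n₀ x') ≤
      C * 2 * (1 / 2) ^ n₀ := by
    intro n₀ m hm
    obtain ⟨k, rfl⟩ := Nat.exists_eq_add_of_le hm
    refine (htel n₀ k).trans ?_
    have := half_pow_pos (n₀ + k)
    gcongr
    linarith
  have hlim : Tendsto (fun n : ℕ => C * 2 * (1 / 2 : ℝ) ^ n) atTop (𝓝 (C * 2 * 0)) :=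
    (tendsto_pow_atTop_nhds_zero_of_lt_one (by norm_num) (by norm_num)).const_mul _
  rw [mul_zero] at hlim
  obtain ⟨n₀, hn₀⟩ := (hlim.eventually_lt_const (show (0 : ℝ) < ε / 4 by positivity)).exists
  have hMε : M * (ε / (4 * (M + 1))) < ε / 4 := by
    have : M / (M + 1) < 1 := by rw [div_lt_one hM1]; linarith
    calc M * (ε / (4 * (M + 1))) = M / (M + 1) * (ε / 4) := by field_simp
      _ < 1 * (ε / 4) := by gcongr
      _ = ε / 4 := one_mul _
  -- All late approximations of x are compared with one approximation of x', so only the stability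
  -- bound on x - x' and the geometric tail at x' enter.
  have key : ∀ m ≥ n₀, p (eulerApprox V t m x - eulerApprox V t n₀ x') < ε / 2 := by
    intro m hm
    have h1 : eulerApprox V t m x - eulerApprox V t n₀ x' = eulerApprox V t m (x - x') +
        (eulerApprox V t m x' - eulerApprox V t n₀ x') := by
      rw [map_sub]; abel
    rw [h1]
    have h2 := hb t le_rfl m (x - x')
    have h3 := htel' n₀ m hm
    have h4 : M * q (x - x') ≤ M * (ε / (4 * (M + 1))) := by gcongr
    exact (map_add_le_add p _ _).trans_lt (by linarith)
  refine ⟨n₀, fun m hm n hn => ?_⟩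
  rw [← sub_sub_sub_cancel_right _ _ (eulerApprox V t n₀ x')]
  exact (map_sub_le_add p _ _).trans_lt (by linarith [key m hm, key n hn])

end IsEulerFamily

end EulerLimit

/-! ### The limit of the Euler scheme is a semigroup with the right derivative at 0. -/

section EulerSemigroup

variable {X : Type*} [AddCommGroup X] [Module ℂ X] [UniformSpace X]
  [IsUniformAddGroup X] [ContinuousSMul ℂ X] [LocallyConvexSpace ℝ X] {nrm : Seminorm ℂ X}

/-- An equicontinuous family of operators that tends to zero on a dense set tends to zero. -/
theorem IsTypeB.tendsto_zero_of_dense (hX : IsTypeB nrm) {ι : Type*} {l : Filter ι}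
    (L : ι → X →ₗ[ℂ] X) (C : ℝ) (hC : 0 ≤ C)
    (hb : ∀ p ∈ dominatedSeminorms nrm, ∃ q ∈ dominatedSeminorms nrm,
      ∀ᶠ i in l, ∀ x, p (L i x) ≤ C * q x)
    {D : Set X} (hD : Dense D) (h : ∀ z ∈ D, Tendsto (fun i => L i z) l (𝓝 0)) (x : X) :
    Tendsto (fun i => L i x) l (𝓝 0) := by
  rw [hX.tendsto_zero_iff]
  intro p hp
  rw [tendsto_order]
  refine ⟨fun a ha => Eventually.of_forall fun i => ha.trans_le (apply_nonneg p _), fun ε hε => ?_⟩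
  obtain ⟨q, hq, hpq⟩ := hb p hp
  have hC1 : 0 < C + 1 := by linarith
  obtain ⟨z, hz, hxz⟩ := exists_seminorm_sub_lt_of_dense hD q hq.1 x
    (ε := ε / (2 * (C + 1))) (by positivity)
  filter_upwards [hpq, ((hX.tendsto_zero_iff.1 (h z hz)) p hp).eventually_lt_const
    (half_pos hε)] with i hi hiz
  have h1 : L i x = L i (x - z) + L i z := by rw [map_sub, sub_add_cancel]
  have h2 : C * q (x - z) ≤ ε / 2 := by
    calc C * q (x - z) ≤ (C + 1) * (ε / (2 * (C + 1))) := by gcongr; linarith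
      _ = ε / 2 := by field_simp
  rw [h1]
  exact (map_add_le_add p _ _).trans_lt (by linarith [hi (x - z)])

variable {G : Submodule ℂ (X × X)} {V : ℝ → Module.End ℂ X} {M : ℝ}

omit [UniformSpace X] [IsUniformAddGroup X] [ContinuousSMul ℂ X] [LocallyConvexSpace ℝ X] in
-- A discrete first-order Taylor estimate. Since y need not lie in the domain of G, it is replaced
-- by some z that does; the error is then small in y - z plus a term of second order in time.
theorem IsEulerFamily.pow_sub_sub_le (hV : IsEulerFamily G V) {p q : Seminorm ℂ X} {t₀ h : ℝ}
    (hh : 0 < h) (hM : 0 ≤ M) (hb : ∀ n : ℕ, n * h ≤ t₀ → ∀ x, p ((V h ^ n) x) ≤ M * q x)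
    {x y z w : X} (hxy : (x, y) ∈ G) (hzw : (z, w) ∈ G) (n : ℕ) (hn : n * h ≤ t₀) :
    p ((V h ^ n) x - x - ((n * h : ℝ) : ℂ) • y) ≤
      n * h * (M * q (y - z) + p (y - z) + t₀ * (M * q w)) := by
  induction n with
  | zero => simp
  | succ n ih =>
    have hn' : n * h ≤ t₀ := le_trans (by gcongr; simp) hn
    have h1 : (V h ^ (n + 1)) x - x - (((n + 1 : ℕ) * h : ℝ) : ℂ) • y =
        ((V h ^ n) x - x - ((n * h : ℝ) : ℂ) • y) + (h : ℂ) • ((V h ^ (n + 1)) y - y) := by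
      have h2 : (V h ^ (n + 1)) x = (V h ^ n) x + (h : ℂ) • (V h ^ (n + 1)) y := by
        rw [pow_succ', Module.End.mul_apply, Module.End.mul_apply,
          ← hV.apply_sub_self hh (hV.pow_mem hh hxy n)]
        abel
      rw [h2]
      push_cast
      module
    have h3 : (V h ^ (n + 1)) y - y = (V h ^ (n + 1)) (y - z) +
        ((V h ^ (n + 1)) z - (V h ^ 0) z) - (y - z) := by
      rw [map_sub, pow_zero, Module.End.one_apply]; abel
    have h4 : p ((V h ^ (n + 1)) y - y) ≤ M * q (y - z) + p (y - z) + t₀ * (M * q w) := by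
      have h5 := hV.pow_sub_pow_le hh hb hzw (Nat.zero_le (n + 1)) hn
      have h6 : (((n + 1 : ℕ) : ℝ) - (0 : ℕ)) * h * (M * q w) ≤ t₀ * (M * q w) := by
        have : 0 ≤ M * q w := mul_nonneg hM (apply_nonneg q w)
        rw [Nat.cast_zero, sub_zero]
        gcongr
      rw [h3]
      refine (map_sub_le_add p _ _).trans ?_
      have h7 := map_add_le_add p ((V h ^ (n + 1)) (y - z)) ((V h ^ (n + 1)) z - (V h ^ 0) z)
      have h8 := hb (n + 1) hn (y - z)
      linarith
    rw [h1]
    refine (map_add_le_add p _ _).trans ?_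
    rw [map_smul_eq_mul, Complex.norm_real, Real.norm_of_nonneg hh.le]
    have h9 := mul_le_mul_of_nonneg_left h4 hh.le
    have h10 := ih hn'
    rw [Nat.cast_succ]
    linarith

variable {S : ℝ≥0 → X →L[ℂ] X}

omit [IsUniformAddGroup X] [ContinuousSMul ℂ X] [LocallyConvexSpace ℝ X] in
theorem le_of_tendsto_eulerApprox (hS : IsStable nrm M V)
    (hlim : ∀ t x, Tendsto (fun j => eulerApprox V t j x) atTop (𝓝 (S t x)))
    {p : Seminorm ℂ X} (hp : p ∈ dominatedSeminorms nrm) (t₀ : ℝ≥0) :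
    ∃ q ∈ dominatedSeminorms nrm, ∀ t ≤ t₀, ∀ x, p (S t x) ≤ M * q x := by
  obtain ⟨q, hq, hb⟩ := hS.eulerApprox_le hp t₀
  exact ⟨q, hq, fun t ht x => le_of_tendsto ((hp.1.tendsto _).comp (hlim t x))
    (Eventually.of_forall fun j => hb t ht j x)⟩

theorem tendsto_floor_mul_half_pow (t : ℝ≥0) :
    Tendsto (fun j => (⌊t * (2 : ℝ≥0) ^ j⌋₊ : ℝ) * (1 / 2) ^ j) atTop (𝓝 (t : ℝ)) := by
  have h : Tendsto (fun j : ℕ => (t : ℝ) - (1 / 2 : ℝ) ^ j) atTop (𝓝 ((t : ℝ) - 0)) :=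
    tendsto_const_nhds.sub (tendsto_pow_atTop_nhds_zero_of_lt_one (by norm_num) (by norm_num))
  rw [sub_zero] at h
  refine tendsto_of_tendsto_of_tendsto_of_le_of_le h tendsto_const_nhds (fun j => ?_)
    fun j => floor_mul_half_pow_le t j
  have := lt_floor_add_one_mul_half_pow t j
  simp only
  linarith

namespace IsEulerFamily

omit [ContinuousSMul ℂ X] [LocallyConvexSpace ℝ X] in
theorem sub_le_of_tendsto (hV : IsEulerFamily G V) (hS : IsStable nrm M V)
    (hlim : ∀ t x, Tendsto (fun j => eulerApprox V t j x) atTop (𝓝 (S t x)))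
    {p : Seminorm ℂ X} (hp : p ∈ dominatedSeminorms nrm) (t₀ : ℝ≥0) :
    ∃ q ∈ dominatedSeminorms nrm, ∀ x y, (x, y) ∈ G → ∀ s t, s ≤ t → t ≤ t₀ →
      p (S t x - S s x) ≤ (t - s) * (M * q y) := by
  obtain ⟨q, hq, hb⟩ := hS p hp t₀
  refine ⟨q, hq, fun x y hxy s t hst ht => ?_⟩
  refine le_of_tendsto_of_tendsto ((hp.1.tendsto _).comp ((hlim t x).sub (hlim s x)))
    (((tendsto_floor_mul_half_pow t).sub (tendsto_floor_mul_half_pow s)).mul_const (M * q y))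
    (Eventually.of_forall fun j => ?_)
  have := hV.pow_sub_pow_le (half_pow_pos j) (hb _ (half_pow_pos j)) hxy
    (m := ⌊s * (2 : ℝ≥0) ^ j⌋₊) (n := ⌊t * (2 : ℝ≥0) ^ j⌋₊) (Nat.floor_le_floor (by gcongr))
    ((floor_mul_half_pow_le t j).trans (by exact_mod_cast ht))
  rw [sub_mul] at this
  exact this

/-- On the domain of G the limit orbits are locally Lipschitz in time; local equicontinuity carries
continuity to all vectors. -/
theorem continuous_of_tendsto (hX : IsTypeB nrm) (hV : IsEulerFamily G V)
    (hS : IsStable nrm M V) (hM : 0 ≤ M) (hD : Dense {x | ∃ y, (x, y) ∈ G})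
    (hlim : ∀ t x, Tendsto (fun j => eulerApprox V t j x) atTop (𝓝 (S t x))) (x : X) :
    Continuous fun t => S t x := by
  rw [continuous_iff_continuousAt]
  intro t
  rw [ContinuousAt, ← tendsto_sub_nhds_zero_iff]
  have hnear : ∀ᶠ s in 𝓝 t, s ≤ t + 1 :=
    (eventually_lt_nhds (lt_add_one t)).mono fun s hs => hs.le
  refine hX.tendsto_zero_of_dense (fun s => (S s - S t : X →L[ℂ] X).toLinearMap) (2 * M)
    (by positivity) (fun p hp => ?_) hD ?_ x
  · obtain ⟨q, hq, hb⟩ := le_of_tendsto_eulerApprox hS hlim hp (t + 1)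
    refine ⟨q, hq, ?_⟩
    filter_upwards [hnear] with s hs x
    refine (map_sub_le_add p (S s x) (S t x)).trans ?_
    linarith [hb s hs x, hb t (le_add_of_nonneg_right zero_le) x]
  · rintro z ⟨w, hzw⟩
    rw [hX.tendsto_zero_iff]
    intro p hp
    obtain ⟨q, hq, hb⟩ := hV.sub_le_of_tendsto hS hlim hp (t + 1)
    have h1 : Tendsto (fun s : ℝ≥0 => |(s : ℝ) - t| * (M * q w)) (𝓝 t) (𝓝 0) := by
      have : Continuous fun s : ℝ≥0 => |(s : ℝ) - t| * (M * q w) := by fun_prop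
      simpa using this.tendsto t
    refine squeeze_zero' (Eventually.of_forall fun _ => apply_nonneg p _) ?_ h1
    filter_upwards [hnear] with s hs
    change p (S s z - S t z) ≤ _
    rcases le_total s t with h | h
    · rw [map_sub_rev, abs_sub_comm, abs_of_nonneg (sub_nonneg.2 (by exact_mod_cast h))]
      exact hb z w hzw s t h (le_add_of_nonneg_right zero_le)
    · rw [abs_of_nonneg (sub_nonneg.2 (by exact_mod_cast h))]
      exact hb z w hzw t s h hs

theorem add_of_tendsto (hX : IsTypeB nrm) (hV : IsEulerFamily G V)
    (hS : IsStable nrm M V) (hD : Dense {x | ∃ y, (x, y) ∈ G})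
    (hlim : ∀ t x, Tendsto (fun j => eulerApprox V t j x) atTop (𝓝 (S t x))) (s t : ℝ≥0) :
    S (s + t) = (S s).comp (S t) := by
  have := hX.t2Space
  refine DFunLike.coe_injective (Continuous.ext_on hD (S (s + t)).continuous
    ((S s).comp (S t)).continuous ?_)
  rintro x ⟨y, hxy⟩
  refine tendsto_nhds_unique (hlim (s + t) x) ?_
  rw [hX.tendsto_iff]
  intro p hp
  obtain ⟨q, hq, hb⟩ := hS p hp (s + t : ℝ≥0)
  have h1 : Tendsto (fun j : ℕ => (1 / 2 : ℝ) ^ j * (M * q y) +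
      M * q (eulerApprox V t j x - S t x) + p (eulerApprox V s j (S t x) - S s (S t x)))
      atTop (𝓝 (0 * (M * q y) + M * 0 + 0)) :=
    (((tendsto_pow_atTop_nhds_zero_of_lt_one (by norm_num) (by norm_num)).mul_const _).add
      ((hX.tendsto_iff.1 (hlim t x) q hq).const_mul M)).add
      (hX.tendsto_iff.1 (hlim s (S t x)) p hp)
  simp only [zero_mul, mul_zero, add_zero] at h1
  refine squeeze_zero (fun _ => apply_nonneg p _) (fun j => ?_) h1
  set h : ℝ := (1 / 2) ^ j
  have hh : 0 < h := half_pow_pos j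
  set n := ⌊s * (2 : ℝ≥0) ^ j⌋₊ with hn
  set m := ⌊t * (2 : ℝ≥0) ^ j⌋₊ with hm
  set k := ⌊(s + t) * (2 : ℝ≥0) ^ j⌋₊ with hk
  have hkh : k * h ≤ (s + t : ℝ≥0) := floor_mul_half_pow_le (s + t) j
  have hnh : n * h ≤ (s + t : ℝ≥0) := (floor_mul_half_pow_le s j).trans (by push_cast; simp)
  -- Rounding s + t yields at most one step more than rounding s and t separately; on the domain of
  -- G that step costs O(h).
  have hkmn : k = n + m ∨ k = n + m + 1 := by
    rw [hk, add_mul]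
    exact floor_add_eq _ _
  have h2 : eulerApprox V (s + t) j x - S s (S t x) =
      ((V h ^ k) x - (V h ^ (n + m)) x) + (V h ^ n) (eulerApprox V t j x - S t x) +
      (eulerApprox V s j (S t x) - S s (S t x)) := by
    have h3 : (V h ^ (n + m)) x = (V h ^ n) (eulerApprox V t j x) := by
      rw [pow_add, Module.End.mul_apply]; rfl
    rw [h3, map_sub]
    change (V h ^ k) x - S s (S t x) = _ + ((V h ^ n) (S t x) - S s (S t x))
    abel
  have h4 := hV.pow_sub_pow_le hh (hb h hh) hxy (show n + m ≤ k by omega) hkh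
  have h5 : ((k : ℝ) - (n + m : ℕ)) ≤ 1 := by
    rcases hkmn with h | h <;> rw [h] <;> push_cast <;> linarith
  have hMq : 0 ≤ M * q y := (apply_nonneg p _).trans
    (hb h hh 0 (by rw [Nat.cast_zero, zero_mul]; exact NNReal.coe_nonneg _) y)
  have h6 : ((k : ℝ) - (n + m : ℕ)) * h * (M * q y) ≤ 1 * h * (M * q y) := by gcongr
  change p (eulerApprox V (s + t) j x - S s (S t x)) ≤ _
  rw [h2]
  refine (map_add_le_add p _ _).trans (add_le_add_left ((map_add_le_add p _ _).trans ?_) _)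
  have h7 := hb h hh n hnh (eulerApprox V t j x - S t x)
  linarith

theorem tendsto_slope_of_tendsto (hX : IsTypeB nrm) (hV : IsEulerFamily G V)
    (hS : IsStable nrm M V) (hM : 0 ≤ M) (hD : Dense {x | ∃ y, (x, y) ∈ G})
    (hlim : ∀ t x, Tendsto (fun j => eulerApprox V t j x) atTop (𝓝 (S t x)))
    {x y : X} (hxy : (x, y) ∈ G) :
    Tendsto (fun t : ℝ≥0 => ((t : ℝ) : ℂ)⁻¹ • (S t x - x)) (𝓝[>] 0) (𝓝 y) := by
  rw [hX.tendsto_iff]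
  intro p hp
  obtain ⟨q, hq, hb⟩ := hS p hp 1
  have hbound : ∀ z w, (z, w) ∈ G → ∀ t : ℝ≥0, 0 < t → t ≤ 1 →
      p (((t : ℝ) : ℂ)⁻¹ • (S t x - x) - y) ≤ M * q (y - z) + p (y - z) + t * (M * q w) := by
    intro z w hzw t ht ht1
    have ht' : (0 : ℝ) < t := ht
    have h1 : p (S t x - x - ((t : ℝ) : ℂ) • y) ≤
        t * (M * q (y - z) + p (y - z) + t * (M * q w)) := by
      refine le_of_tendsto_of_tendsto ((hp.1.tendsto _).comp (((hlim t x).sub_const x).sub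
        (((Complex.continuous_ofReal.tendsto _).comp (tendsto_floor_mul_half_pow t)).smul_const y)))
        ((tendsto_floor_mul_half_pow t).mul_const _) (Eventually.of_forall fun j => ?_)
      exact hV.pow_sub_sub_le (half_pow_pos j) hM
        (fun n hn => hb _ (half_pow_pos j) n (hn.trans (by exact_mod_cast ht1))) hxy hzw _
        (floor_mul_half_pow_le t j)
    have h2 : ((t : ℝ) : ℂ)⁻¹ • (S t x - x) - y =
        ((t : ℝ) : ℂ)⁻¹ • (S t x - x - ((t : ℝ) : ℂ) • y) := by
      rw [smul_sub _ (S t x - x), inv_smul_smul₀ (by exact_mod_cast ht.ne')]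
    rw [h2, map_smul_eq_mul, norm_inv, Complex.norm_real, Real.norm_of_nonneg ht'.le,
      inv_mul_le_iff₀ ht']
    exact h1
  rw [tendsto_order]
  refine ⟨fun a ha => Eventually.of_forall fun i => ha.trans_le (apply_nonneg p _), fun ε hε => ?_⟩
  have hM1 : 0 < M + 1 := by linarith
  obtain ⟨z, ⟨w, hzw⟩, hz⟩ := exists_seminorm_sub_lt_of_dense hD (p ⊔ q)
    (sup_mem_dominatedSeminorms hp hq).1 y (ε := ε / (2 * (M + 1))) (by positivity)
  have h1 : M * q (y - z) + p (y - z) ≤ ε / 2 := by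
    have hpz : p (y - z) ≤ (p ⊔ q) (y - z) := le_sup_left (a := p) (b := q) (y - z)
    have hqz : q (y - z) ≤ (p ⊔ q) (y - z) := le_sup_right (a := p) (b := q) (y - z)
    calc M * q (y - z) + p (y - z) ≤ M * (p ⊔ q) (y - z) + (p ⊔ q) (y - z) := by gcongr
      _ = (M + 1) * (p ⊔ q) (y - z) := by ring
      _ ≤ (M + 1) * (ε / (2 * (M + 1))) := by gcongr
      _ = ε / 2 := by field_simp
  have h2 : Tendsto (fun t : ℝ≥0 => (t : ℝ) * (M * q w)) (𝓝[>] 0) (𝓝 0) := by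
    have : Continuous fun t : ℝ≥0 => (t : ℝ) * (M * q w) := by fun_prop
    have := this.tendsto 0
    simp only [NNReal.coe_zero, zero_mul] at this
    exact this.mono_left nhdsWithin_le_nhds
  filter_upwards [h2.eventually_lt_const (half_pos hε),
    Ioc_mem_nhdsGT (one_pos (α := ℝ≥0))] with t ht ht1
  linarith [hbound z w hzw t ht1.1 ht1.2]

/-- The Euler scheme of a densely defined relation converges to a semigroup. -/
theorem exists_semigroup (hX : IsTypeB nrm) (hV : IsEulerFamily G V)
    (hS : IsStable nrm M V) (hM : 0 ≤ M) (hD : Dense {x | ∃ y, (x, y) ∈ G}) :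
    ∃ S : ℝ≥0 → X →L[ℂ] X, IsStronglyContinuousSemigroup S ∧ IsOfType nrm S M 0 ∧
      ∀ x y, (x, y) ∈ G →
        Tendsto (fun t : ℝ≥0 => ((t : ℝ) : ℂ)⁻¹ • (S t x - x)) (𝓝[>] 0) (𝓝 y) := by
  have := hX.t2Space
  choose F hF using hV.exists_tendsto_eulerApprox hX hS hM hD
  let L : ℝ≥0 → X →ₗ[ℂ] X := fun t =>
    { toFun := F t
      map_add' := fun x y => tendsto_nhds_unique (hF t (x + y))
        (by simpa only [map_add] using (hF t x).add (hF t y))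
      map_smul' := fun c x => tendsto_nhds_unique (hF t (c • x))
        (by simpa only [map_smul, RingHom.id_apply] using (hF t x).const_smul c) }
  have hL : ∀ t, Continuous (L t) := by
    refine fun t => hX.continuous_of_bound (L t) M fun p hp => ?_
    obtain ⟨q, hq, hb⟩ := hS.eulerApprox_le hp t
    exact ⟨q, hq, fun x => le_of_tendsto ((hp.1.tendsto _).comp (hF t x))
      (Eventually.of_forall fun j => hb t le_rfl j x)⟩
  let S : ℝ≥0 → X →L[ℂ] X := fun t => ⟨L t, hL t⟩
  have hlim : ∀ t x, Tendsto (fun j => eulerApprox V t j x) atTop (𝓝 (S t x)) := hF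
  refine ⟨S, ⟨?_, hV.add_of_tendsto hX hS hD hlim, hV.continuous_of_tendsto hX hS hM hD hlim⟩,
    fun p hp t₀ => ?_, fun x y hxy => hV.tendsto_slope_of_tendsto hX hS hM hD hlim hxy⟩
  · ext x
    refine tendsto_nhds_unique (hlim 0 x) ?_
    simp [eulerApprox]
  · obtain ⟨q, hq, hb⟩ := le_of_tendsto_eulerApprox hS hlim hp t₀
    exact ⟨q, hq, fun x t ht => by simpa using hb t ht x⟩

end IsEulerFamily

end EulerSemigroup

/-! ### Resolvents as Euler steps. -/

section Resolvent

variable {X : Type*} [AddCommGroup X] [Module ℂ X] {A : X →ₗ.[ℂ] X} {l : ℂ}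

theorem opResolvent_mem_graph (hl : l ∈ opResolventSet A) (x : X) :
    (opResolvent A l x, l • opResolvent A l x - x) ∈ A.graph := by
  have hb : Function.Bijective (subOp A l) := hl
  set z : A.domain := (LinearEquiv.ofBijective (subOp A l) hb).symm x with hz
  have h1 : opResolvent A l x = z := by simp [opResolvent, hb, hz]
  have h2 : subOp A l z = x := (LinearEquiv.ofBijective (subOp A l) hb).apply_symm_apply x
  rw [h1, LinearPMap.mem_graph_iff]
  refine ⟨z, rfl, ?_⟩
  rw [eq_sub_iff_add_eq, ← eq_sub_iff_add_eq']
  exact h2.symm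

theorem opResolvent_smul_sub (hl : l ∈ opResolventSet A) {x y : X} (hxy : (x, y) ∈ A.graph) :
    opResolvent A l (l • x - y) = x := by
  have hb : Function.Bijective (subOp A l) := hl
  obtain ⟨z, rfl, rfl⟩ := (LinearPMap.mem_graph_iff A).1 hxy
  have h1 : (LinearEquiv.ofBijective (subOp A l) hb).symm (subOp A l z) = z :=
    (LinearEquiv.ofBijective (subOp A l) hb).symm_apply_apply z
  have h2 : opResolvent A l (subOp A l z) = z := by simp [opResolvent, hb, h1]
  exact h2

theorem mem_opResolventSet (hinj : ∀ x, (x, l • x) ∈ A.graph → x = 0)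
    (hsurj : ∀ x, ∃ y, (y, l • y - x) ∈ A.graph) : l ∈ opResolventSet A := by
  refine ⟨(injective_iff_map_eq_zero _).2 fun z hz => ?_, fun x => ?_⟩
  · have h1 : l • (z : X) = A z := sub_eq_zero.1 hz
    exact Subtype.ext (hinj z (h1 ▸ A.mem_graph z))
  · obtain ⟨y, hy⟩ := hsurj x
    obtain ⟨z, rfl, hz⟩ := (LinearPMap.mem_graph_iff A).1 hy
    refine ⟨z, ?_⟩
    change l • (z : X) - A z = x
    rw [hz, sub_sub_cancel]

/-- The graph of `A - ω`. -/
def shiftedGraph (A : X →ₗ.[ℂ] X) (ω : ℂ) : Submodule ℂ (X × X) :=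
  A.graph.comap ((LinearMap.fst ℂ X X).prod (LinearMap.snd ℂ X X + ω • LinearMap.fst ℂ X X))

theorem mem_shiftedGraph {ω : ℂ} {x y : X} :
    (x, y) ∈ shiftedGraph A ω ↔ (x, y + ω • x) ∈ A.graph := Iff.rfl

/-- The implicit Euler step `h⁻¹ R(ω + h⁻¹)` of `A - ω`. -/
noncomputable def eulerStep (A : X →ₗ.[ℂ] X) (ω h : ℝ) : Module.End ℂ X :=
  ((h⁻¹ : ℝ) : ℂ) • opResolvent A ((ω + h⁻¹ : ℝ) : ℂ)

/-- The point is that 1 - h(A - ω) = h((ω + h⁻¹) - A). -/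
theorem isEulerFamily_eulerStep {ω : ℝ} (hA : ∀ l : ℝ, ω < l → (l : ℂ) ∈ opResolventSet A) :
    IsEulerFamily (shiftedGraph A ω) (eulerStep A ω) where
  mem_graph h hh x := by
    have hl := opResolvent_mem_graph (hA (ω + h⁻¹) (by simpa using hh)) x
    rw [mem_shiftedGraph]
    convert A.graph.smul_mem (h : ℂ)⁻¹ hl using 1
    simp only [eulerStep, LinearMap.smul_apply, Prod.smul_mk, Prod.mk.injEq]
    push_cast
    exact ⟨rfl, by module⟩
  apply_sub h hh x y hxy := by
    have hl := opResolvent_smul_sub (hA (ω + h⁻¹) (by simpa using hh)) (mem_shiftedGraph.1 hxy)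
    have h0 : (h : ℂ) ≠ 0 := by exact_mod_cast hh.ne'
    have h1 : ((h⁻¹ : ℝ) : ℂ) • (x - (h : ℂ) • y) =
        ((ω + h⁻¹ : ℝ) : ℂ) • x - (y + (ω : ℂ) • x) := by
      rw [smul_sub, Complex.ofReal_inv, inv_smul_smul₀ h0]
      push_cast
      module
    rw [eulerStep, LinearMap.smul_apply, ← map_smul, h1, hl]

theorem isStable_eulerStep [UniformSpace X] {nrm : Seminorm ℂ X} {M ω : ℝ} (hM : 1 ≤ M)
    (hA : ∀ p ∈ dominatedSeminorms nrm, ∀ l₀ : ℝ, ω < l₀ → ∃ q ∈ dominatedSeminorms nrm,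
          ∀ x : X, ∀ n : ℕ, 1 ≤ n → ∀ l : ℝ, l₀ ≤ l →
            p ((((n * (l - ω) : ℝ) : ℂ) • opResolvent A ((ω + n * (l - ω) : ℝ) : ℂ)) ^ n <| x)
              ≤ M * q x) :
    IsStable nrm M (eulerStep A ω) := by
  intro p hp t₀
  have ht : 0 < max t₀ 1 := lt_max_of_lt_right one_pos
  -- The condition nh ≤ t₀ becomes a lower bound on λ = ω + 1/(nh); the maximum with 1 keeps the
  -- threshold above ω even when t₀ ≤ 0.
  obtain ⟨q, hq, hb⟩ := hA p hp (ω + (max t₀ 1)⁻¹) (by simp)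
  -- Joining p covers n = 0, which the resolvent estimate leaves out; there M ≥ 1 is needed.
  refine ⟨p ⊔ q, ⟨hp.1.sup hq.1, sup_le hp.2 hq.2⟩, fun h hh n hn x => ?_⟩
  have hM0 : 0 ≤ M := zero_le_one.trans hM
  rcases Nat.eq_zero_or_pos n with rfl | hn0
  · calc p x ≤ (p ⊔ q) x := le_sup_left (a := p) (b := q) x
      _ ≤ M * (p ⊔ q) x := le_mul_of_one_le_left (apply_nonneg _ x) hM
  · have hn' : (0 : ℝ) < n := by exact_mod_cast hn0
    have h1 := hb x n hn0 (ω + (n * h)⁻¹)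
      (by gcongr; exact hn.trans (le_max_left _ _))
    have h2 : (n : ℝ) * (ω + (n * h)⁻¹ - ω) = h⁻¹ := by field_simp; ring
    rw [h2] at h1
    refine h1.trans ?_
    gcongr
    exact le_sup_right (a := p) (b := q) x

end Resolvent

/-! ### Decay of orbits, uniqueness, and the implication from (b) to (a). -/

section Semigroup

variable {X : Type*} [AddCommGroup X] [Module ℂ X] [UniformSpace X]
  {nrm : Seminorm ℂ X} {T : ℝ≥0 → X →L[ℂ] X} {M ω : ℝ}

/-- Replacing q by the norm removes its dependence on the time horizon. This global bound secures
convergence of Laplace integrals, though it is too weak for τ-equicontinuity. -/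
theorem IsOfType.apply_le (hT : IsOfType nrm T M ω) (hM : 0 ≤ M) {p : Seminorm ℂ X}
    (hp : p ∈ dominatedSeminorms nrm) (t : ℝ≥0) (x : X) :
    Real.exp (-ω * t) * p (T t x) ≤ M * nrm x := by
  obtain ⟨q, hq, hb⟩ := hT p hp t
  exact (hb x t le_rfl).trans (by gcongr; exact hq.2 x)

theorem tendsto_toNNReal_sub (t : ℝ) :
    Tendsto (fun s : ℝ => (s - t).toNNReal) (𝓝[>] t) (𝓝[>] 0) := by
  refine tendsto_nhdsWithin_iff.2 ⟨?_, ?_⟩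
  · have : Continuous fun s : ℝ => (s - t).toNNReal := by fun_prop
    simpa using (this.tendsto t).mono_left nhdsWithin_le_nhds
  · filter_upwards [self_mem_nhdsWithin] with s hs
    exact Real.toNNReal_pos.2 (sub_pos.2 hs)

theorem IsStronglyContinuousSemigroup.hasDerivWithinAt (hT : IsStronglyContinuousSemigroup T)
    {x y : X} (hxy : Tendsto (fun t : ℝ≥0 => ((t : ℝ) : ℂ)⁻¹ • (T t x - x)) (𝓝[>] 0) (𝓝 y))
    (f : X →L[ℂ] ℂ) {t : ℝ} (ht : 0 ≤ t) :
    HasDerivWithinAt (fun s : ℝ => f (T s.toNNReal x)) (f (T t.toNNReal y)) (Set.Ici t) t := by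
  rw [← hasDerivWithinAt_Ioi_iff_Ici, hasDerivWithinAt_iff_tendsto_slope' Set.self_notMem_Ioi]
  have h1 := ((f.comp (T t.toNNReal)).continuous.tendsto y).comp
    (hxy.comp (tendsto_toNNReal_sub t))
  refine h1.congr' ?_
  filter_upwards [self_mem_nhdsWithin] with s hs
  have hs' : t < s := hs
  have h2 : s.toNNReal = t.toNNReal + (s - t).toNNReal := by
    rw [← Real.toNNReal_add ht (sub_nonneg.2 hs'.le), add_sub_cancel]
  simp only [Function.comp_apply, slope_def_module]
  rw [h2, hT.add, map_smul, Real.coe_toNNReal _ (sub_nonneg.2 hs'.le)]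
  simp only [ContinuousLinearMap.comp_apply, map_sub, ← Complex.ofReal_inv, Complex.coe_smul]

variable [IsUniformAddGroup X] [ContinuousSMul ℂ X] [LocallyConvexSpace ℝ X]

/-- Tested against a functional, e^{-lt}T(t)x has zero right derivative and is constant, while its
size is at most a multiple of e^{(ω - Re l)t}, which tends to 0. -/
theorem IsStronglyContinuousSemigroup.eq_zero_of_eigenvector (hX : IsTypeB nrm)
    (hT : IsStronglyContinuousSemigroup T) (hM : 0 ≤ M) (hTM : IsOfType nrm T M ω) {l : ℂ}
    (hl : ω < l.re) {x : X}
    (hx : Tendsto (fun t : ℝ≥0 => ((t : ℝ) : ℂ)⁻¹ • (T t x - x)) (𝓝[>] 0) (𝓝 (l • x))) :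
    x = 0 := by
  refine hX.eq_zero fun p hp => le_antisymm ?_ (apply_nonneg p x)
  obtain ⟨f, hfx, hf⟩ := exists_functional_eq_seminorm p hp.1 x
  have hconst : ∀ t : ℝ, 0 ≤ t → Complex.exp (-l * t) * f (T t.toNNReal x) = f x := by
    intro t ht
    have hd : ∀ s ∈ Set.Ico 0 t, HasDerivWithinAt
        (fun s : ℝ => Complex.exp (-l * s) * f (T s.toNNReal x)) 0 (Set.Ici s) s := by
      intro s hs
      have h1 : HasDerivWithinAt (fun s : ℝ => Complex.exp (-l * s))
          (Complex.exp (-l * s) * (-l * 1)) (Set.Ici s) s := by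
        have := ((Complex.ofRealCLM.hasDerivAt (x := s)).const_mul (-l)).cexp
        simpa using this.hasDerivWithinAt
      have h2 := h1.mul (hT.hasDerivWithinAt hx f hs.1)
      have h0 : Complex.exp (-l * s) * (-l * 1) * f (T s.toNNReal x) +
          Complex.exp (-l * s) * f (T s.toNNReal (l • x)) = 0 := by
        simp only [map_smul, smul_eq_mul]
        ring
      rw [h0] at h2
      exact h2
    have hc : ContinuousOn (fun s : ℝ => Complex.exp (-l * s) * f (T s.toNNReal x))
        (Set.Icc 0 t) := by
      have h1 : Continuous fun s : ℝ => T s.toNNReal x :=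
        (hT.continuous x).comp continuous_real_toNNReal
      have h2 : Continuous fun s : ℝ => Complex.exp (-l * s) := by fun_prop
      exact (h2.mul (f.continuous.comp h1)).continuousOn
    have := constant_of_has_deriv_right_zero hc hd t ⟨ht, le_rfl⟩
    simpa [hT.zero] using this
  have hle : ∀ t : ℝ, 0 ≤ t → p x ≤ Real.exp ((ω - l.re) * t) * (M * nrm x) := by
    intro t ht
    have h1 := congrArg norm (hconst t ht)
    rw [norm_mul, hfx, Complex.norm_real, Real.norm_of_nonneg (apply_nonneg p x),
      Complex.norm_exp] at h1
    have h2 := hTM.apply_le hM hp t.toNNReal x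
    rw [Real.coe_toNNReal t ht] at h2
    have h3 : (-l * (t : ℂ)).re = (ω - l.re) * t + -ω * t := by simp; ring
    rw [h3, Real.exp_add, mul_assoc] at h1
    rw [← h1]
    refine mul_le_mul_of_nonneg_left (le_trans ?_ h2) (Real.exp_pos _).le
    exact mul_le_mul_of_nonneg_left (hf _) (Real.exp_pos _).le
  have hlim : Tendsto (fun t : ℝ => Real.exp ((ω - l.re) * t) * (M * nrm x)) atTop
      (𝓝 (0 * (M * nrm x))) := by
    refine (Real.tendsto_exp_atBot.comp ?_).mul_const _
    exact tendsto_id.const_mul_atTop_of_neg (by linarith)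
  rw [zero_mul] at hlim
  exact ge_of_tendsto hlim ((eventually_ge_atTop 0).mono hle)

/-- The Hille–Yosida theorem, construction of the semigroup. -/
theorem exists_semigroup_of_resolvent (hX : IsTypeB nrm) {A : X →ₗ.[ℂ] X} (hM : 1 ≤ M)
    (hd : Dense (A.domain : Set X)) (hρ : ∀ l : ℝ, ω < l → (l : ℂ) ∈ opResolventSet A)
    (hA : ∀ p ∈ dominatedSeminorms nrm, ∀ l₀ : ℝ, ω < l₀ → ∃ q ∈ dominatedSeminorms nrm,
          ∀ x : X, ∀ n : ℕ, 1 ≤ n → ∀ l : ℝ, l₀ ≤ l →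
            p ((((n * (l - ω) : ℝ) : ℂ) • opResolvent A ((ω + n * (l - ω) : ℝ) : ℂ)) ^ n <| x)
              ≤ M * q x) :
    ∃ T : ℝ≥0 → X →L[ℂ] X,
      IsStronglyContinuousSemigroup T ∧ IsOfType nrm T M ω ∧ IsGenerator T A := by
  have hM0 : 0 ≤ M := zero_le_one.trans hM
  have hD : Dense {x | ∃ y, (x, y) ∈ shiftedGraph A ω} := by
    refine hd.mono fun x hx => ⟨A ⟨x, hx⟩ - (ω : ℂ) • x, ?_⟩
    rw [mem_shiftedGraph, sub_add_cancel]
    exact A.mem_graph ⟨x, hx⟩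
  obtain ⟨S, hS, hSM, hgen⟩ := (isEulerFamily_eulerStep hρ).exists_semigroup hX
    (isStable_eulerStep hM hA) hM0 hD
  let T : ℝ≥0 → X →L[ℂ] X := fun t => ((Real.exp (ω * t) : ℝ) : ℂ) • S t
  have hTapp : ∀ t x, T t x = ((Real.exp (ω * t) : ℝ) : ℂ) • S t x := fun _ _ => rfl
  have hT : IsStronglyContinuousSemigroup T := by
    refine ⟨?_, fun s t => ?_, fun x => ?_⟩
    · ext x
      simp [hTapp, hS.zero]
    · ext x
      simp only [hTapp, hS.add, ContinuousLinearMap.comp_apply, map_smul, smul_smul]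
      rw [← Complex.ofReal_mul, ← Real.exp_add]
      push_cast
      ring_nf
    · simp only [hTapp]
      have : Continuous fun t : ℝ≥0 => ((Real.exp (ω * t) : ℝ) : ℂ) := by fun_prop
      exact this.smul (hS.continuous x)
  have hTM : IsOfType nrm T M ω := by
    intro p hp t₀
    obtain ⟨q, hq, hb⟩ := hSM p hp t₀
    refine ⟨q, hq, fun x t ht => ?_⟩
    rw [hTapp, map_smul_eq_mul, Complex.norm_real, Real.norm_of_nonneg (Real.exp_pos _).le,
      ← mul_assoc, ← Real.exp_add]
    simpa using hb x t ht
  have hsub : ∀ x y, (x, y) ∈ A.graph →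
      Tendsto (fun t : ℝ≥0 => ((t : ℝ) : ℂ)⁻¹ • (T t x - x)) (𝓝[>] 0) (𝓝 y) := by
    intro x y hxy
    have h1 := hgen x (y - (ω : ℂ) • x) (by rwa [mem_shiftedGraph, sub_add_cancel])
    have h2 : Tendsto (fun t : ℝ≥0 => ((Real.exp (ω * t) : ℝ) : ℂ)) (𝓝[>] 0) (𝓝 1) := by
      have : Continuous fun t : ℝ≥0 => ((Real.exp (ω * t) : ℝ) : ℂ) := by fun_prop
      simpa using (this.tendsto 0).mono_left nhdsWithin_le_nhds
    have h3 : Tendsto (fun t : ℝ≥0 => ((((t : ℝ)⁻¹ * (Real.exp (ω * t) - 1) : ℝ)) : ℂ))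
        (𝓝[>] 0) (𝓝 (ω : ℂ)) := by
      refine (Complex.continuous_ofReal.tendsto ω).comp ?_
      have h4 : HasDerivAt (fun t : ℝ => Real.exp (ω * t)) (Real.exp (ω * 0) * (ω * 1)) 0 :=
        ((hasDerivAt_id (0 : ℝ)).const_mul ω).exp
      have h5 := (hasDerivAt_iff_tendsto_slope.1 h4).comp
        (show Tendsto (fun t : ℝ≥0 => (t : ℝ)) (𝓝[>] 0) (𝓝[≠] 0) from
          tendsto_nhdsWithin_iff.2 ⟨by
            simpa using (NNReal.continuous_coe.tendsto 0).mono_left nhdsWithin_le_nhds, by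
            filter_upwards [self_mem_nhdsWithin] with t ht
            exact (NNReal.coe_pos.2 ht).ne'⟩)
      simpa [Function.comp_def, slope_def_module] using h5
    have h6 := (h2.smul h1).add (h3.smul_const x)
    rw [one_smul, sub_add_cancel] at h6
    refine h6.congr fun t => ?_
    rw [hTapp]
    push_cast
    module
  refine ⟨T, hT, hTM, fun x y => ⟨hsub x y, fun hxy => ?_⟩⟩
  -- Maximality: any l > ω would do. The vector z in the domain of A solves lz - Az = lx - y, so x -
  -- z is an eigenvector of the generator for l and must vanish.
  set l : ℝ := ω + 1 with hl
  have hlρ := hρ l (by linarith)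
  have hz := opResolvent_mem_graph hlρ ((l : ℂ) • x - y)
  set z := opResolvent A l ((l : ℂ) • x - y) with hzdef
  have h1 : Tendsto (fun t : ℝ≥0 => ((t : ℝ) : ℂ)⁻¹ • (T t (x - z) - (x - z))) (𝓝[>] 0)
      (𝓝 ((l : ℂ) • (x - z))) := by
    have h2 := hxy.sub (hsub _ _ hz)
    have h3 : y - ((l : ℂ) • z - ((l : ℂ) • x - y)) = (l : ℂ) • (x - z) := by module
    rw [h3] at h2
    refine h2.congr fun t => ?_
    rw [map_sub]
    module
  have h4 := hT.eq_zero_of_eigenvector hX hM0 hTM (l := l) (by simp [hl]) h1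
  rw [sub_eq_zero] at h4
  rw [← h4] at hz
  simpa using hz

end Semigroup

/-! ### Weak integrals in a sequentially complete space. -/

section WeakIntegral

open MeasureTheory Set

/-- The vector `y` is the weak integral of `f` over `(0, ∞)`. -/
def HasWeakIntegral {X : Type*} [AddCommGroup X] [Module ℂ X] [UniformSpace X] (f : ℝ → X)
    (y : X) : Prop :=
  ∀ g : X →L[ℂ] ℂ, IntegrableOn (fun t => g (f t)) (Ioi 0) ∧ ∫ t in Ioi 0, g (f t) = g y

variable {X : Type*} [AddCommGroup X] [Module ℂ X] [UniformSpace X]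
  [IsUniformAddGroup X] [ContinuousSMul ℂ X] [LocallyConvexSpace ℝ X]
  {nrm : Seminorm ℂ X}

/-- A functional on the dual which is the limit of evaluations, uniformly on equicontinuous sets,
is an evaluation. -/
theorem IsTypeB.exists_eq_of_approx (hX : IsTypeB nrm) (I : (X →L[ℂ] ℂ) → ℂ) (z : ℕ → X)
    (h : ∀ p : Seminorm ℂ X, Continuous p → ∀ ε > 0, ∀ᶠ n in atTop,
      ∀ g : X →L[ℂ] ℂ, (∀ x, ‖g x‖ ≤ p x) → ‖g (z n) - I g‖ ≤ ε) :
    ∃ y, ∀ g : X →L[ℂ] ℂ, I g = g y := by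
  obtain ⟨y, hy⟩ := hX.seqComplete z <| hX.cauchySeq fun p hp ε hε => by
    obtain ⟨n₀, hn₀⟩ := eventually_atTop.1 (h p hp.1 (ε / 3) (by positivity))
    refine ⟨n₀, fun m hm n hn => ?_⟩
    obtain ⟨g, hg, hgp⟩ := exists_functional_eq_seminorm p hp.1 (z m - z n)
    have h1 : p (z m - z n) = ‖(g (z m) - I g) - (g (z n) - I g)‖ := by
      rw [sub_sub_sub_cancel_right, ← map_sub, hg, Complex.norm_real,
        Real.norm_of_nonneg (apply_nonneg p _)]
    rw [h1]
    refine (norm_sub_le _ _).trans_lt ?_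
    linarith [hn₀ m hm g hgp, hn₀ n hn g hgp]
  refine ⟨y, fun g => ?_⟩
  have h1 : Tendsto (fun n => g (z n)) atTop (𝓝 (I g)) := by
    rw [Metric.tendsto_nhds]
    intro ε hε
    -- A single functional g is controlled by the continuous seminorm x ↦ ‖g x‖.
    filter_upwards [h g.toLinearMap.toSeminorm g.continuous.norm (ε / 2) (half_pos hε)] with n hn
    rw [dist_eq_norm]
    exact (hn g fun x => le_rfl).trans_lt (half_lt_self hε)
  exact tendsto_nhds_unique h1 ((g.continuous.tendsto y).comp hy)

/-- A continuous function on a compact interval has a weak integral. -/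
theorem IsTypeB.exists_intervalIntegral (hX : IsTypeB nrm) {f : ℝ → X} (hf : Continuous f)
    {R : ℝ} (hR : 0 < R) :
    ∃ y, ∀ g : X →L[ℂ] ℂ, ∫ t in 0..R, g (f t) = g y := by
  -- Left-endpoint Riemann sums on n + 1 equal pieces. Uniform continuity of f with respect to p
  -- makes the error uniform over all g dominated by p.
  set a : ℕ → ℕ → ℝ := fun n k => R * k / (n + 1) with ha
  have hstep : ∀ n k, a n (k + 1) - a n k = R / (n + 1) := fun n k => by
    simp only [ha]; push_cast; ring
  have hlast : ∀ n, a n (n + 1) = R := fun n => by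
    simp only [ha]; push_cast; field_simp
  refine hX.exists_eq_of_approx _
    (fun n => ∑ k ∈ Finset.range (n + 1), ((R / (n + 1) : ℝ) : ℂ) • f (a n k)) fun p hp ε hε => ?_
  have hu := isCompact_Icc.uniformContinuousOn_of_continuous (hf.continuousOn (s := Icc 0 R))
  have hV : {z : X × X | p (z.2 - z.1) < ε / R} ∈ uniformity X := by
    rw [uniformity_eq_comap_nhds_zero X]
    have : {x : X | p x < ε / R} ∈ 𝓝 (0 : X) :=
      (isOpen_lt hp continuous_const).mem_nhds (by simpa using div_pos hε hR)
    exact preimage_mem_comap this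
  have h1 := hu hV
  rw [mem_map, mem_inf_principal, Metric.mem_uniformity_dist] at h1
  obtain ⟨δ, hδ, h2⟩ := h1
  have h3 : Tendsto (fun n : ℕ => R / ((n : ℝ) + 1)) atTop (𝓝 0) := by
    have := (tendsto_one_div_add_atTop_nhds_zero_nat (𝕜 := ℝ)).const_mul R
    simpa only [mul_one_div, mul_zero] using this
  filter_upwards [h3.eventually_lt_const hδ] with n hn g hg
  have hgf : Continuous fun t => g (f t) := g.continuous.comp hf
  have hsum : ∫ t in 0..R, g (f t) =
      ∑ k ∈ Finset.range (n + 1), ∫ t in a n k..a n (k + 1), g (f t) := by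
    rw [intervalIntegral.sum_integral_adjacent_intervals
      fun k _ => hgf.intervalIntegrable _ _, hlast]
    simp [ha]
  have hterm : ∀ k ∈ Finset.range (n + 1), ‖((R / (n + 1) : ℝ) : ℂ) * g (f (a n k)) -
      ∫ t in a n k..a n (k + 1), g (f t)‖ ≤ ε / R * (R / (n + 1)) := by
    intro k hk
    have hk' : k + 1 ≤ n + 1 := Finset.mem_range.1 hk
    have hpos : 0 < R / ((n : ℝ) + 1) := by positivity
    have hak : 0 ≤ a n k := by simp only [ha]; positivity
    have hle : a n (k + 1) ≤ R := by
      rw [← hlast n]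
      simp only [ha]
      gcongr
    have hs := hstep n k
    have h4 : ((R / (n + 1) : ℝ) : ℂ) * g (f (a n k)) = ∫ t in a n k..a n (k + 1), g (f (a n k)) := by
      rw [intervalIntegral.integral_const, hs, Complex.real_smul]
    rw [h4, ← intervalIntegral.integral_sub (by simp) (hgf.intervalIntegrable _ _), ← hs,
      ← abs_of_pos (hs ▸ hpos : 0 < a n (k + 1) - a n k)]
    refine intervalIntegral.norm_integral_le_of_norm_le_const fun t ht => ?_
    rw [uIoc_of_le (by linarith)] at ht
    rw [← map_sub]
    refine (hg _).trans (le_of_lt ?_)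
    refine h2 (a := t) (b := a n k) ?_ ⟨⟨by linarith [ht.1], by linarith [ht.2]⟩,
      ⟨hak, by linarith⟩⟩
    rw [Real.dist_eq, abs_of_nonneg (by linarith [ht.1])]
    linarith [ht.2]
  rw [map_sum, hsum]
  simp only [map_smul, smul_eq_mul]
  rw [← Finset.sum_sub_distrib]
  refine (norm_sum_le_of_le _ hterm).trans (le_of_eq ?_)
  rw [Finset.sum_const, Finset.card_range, nsmul_eq_mul]
  push_cast
  field_simp

/-- An exponentially decaying continuous function has a weak integral over `(0, ∞)`. -/
theorem IsTypeB.exists_hasWeakIntegral (hX : IsTypeB nrm) {f : ℝ → X} (hf : Continuous f) {c : ℝ}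
    (hc : 0 < c) (hb : ∀ p : Seminorm ℂ X, Continuous p →
      ∃ C, ∀ t, 0 ≤ t → p (f t) ≤ C * Real.exp (-c * t)) :
    ∃ y, HasWeakIntegral f y := by
  have hexp : ∀ C a : ℝ, IntegrableOn (fun t => C * Real.exp (-c * t)) (Ioi a) := fun C a =>
    (integrableOn_exp_mul_Ioi (neg_lt_zero.2 hc) a).const_mul C
  have hint : ∀ g : X →L[ℂ] ℂ, IntegrableOn (fun t => g (f t)) (Ioi 0) := by
    intro g
    obtain ⟨C, hC⟩ := hb g.toLinearMap.toSeminorm g.continuous.norm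
    refine Integrable.mono' (hexp C 0) (g.continuous.comp hf).aestronglyMeasurable ?_
    filter_upwards [ae_restrict_mem measurableSet_Ioi] with t ht using hC t (le_of_lt ht)
  choose z hz using fun n : ℕ => hX.exists_intervalIntegral hf (R := n + 1) (by positivity)
  obtain ⟨y, hy⟩ := hX.exists_eq_of_approx (fun g => ∫ t in Ioi 0, g (f t)) z
    fun p hp ε hε => by
      obtain ⟨C, hC⟩ := hb p hp
      have h1 : Tendsto (fun n : ℕ => C * (-Real.exp (-c * (n + 1)) / -c)) atTop
          (𝓝 (C * (-0 / -c))) := by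
        refine Tendsto.const_mul _ (Tendsto.div_const (Tendsto.neg ?_) _)
        refine Real.tendsto_exp_atBot.comp ?_
        exact (tendsto_natCast_atTop_atTop.atTop_add tendsto_const_nhds).const_mul_atTop_of_neg
          (neg_lt_zero.2 hc)
      rw [neg_zero, zero_div, mul_zero] at h1
      filter_upwards [h1.eventually_lt_const hε] with n hn g hg
      have hn0 : (0 : ℝ) ≤ n + 1 := by positivity
      have h2 := intervalIntegral.integral_interval_add_Ioi (hint g)
        ((hint g).mono_set (Ioi_subset_Ioi hn0))
      rw [← hz n g, ← h2, sub_add_cancel_left, norm_neg]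
      refine le_trans (norm_integral_le_of_norm_le (hexp C (n + 1)) ?_) ?_
      · filter_upwards [ae_restrict_mem measurableSet_Ioi] with t ht
        exact (hg _).trans (hC t (hn0.trans (le_of_lt ht)))
      · rw [integral_const_mul, integral_exp_mul_Ioi (neg_lt_zero.2 hc)]
        exact hn.le
  exact ⟨y, fun g => ⟨hint g, hy g⟩⟩

namespace HasWeakIntegral

variable {f : ℝ → X} {y : X}

omit [IsUniformAddGroup X] [ContinuousSMul ℂ X] [LocallyConvexSpace ℝ X] in
theorem map (h : HasWeakIntegral f y) (T : X →L[ℂ] X) :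
    HasWeakIntegral (fun t => T (f t)) (T y) := fun g => h (g.comp T)

theorem seminorm_le (h : HasWeakIntegral f y) {p : Seminorm ℂ X} (hp : Continuous p) {b : ℝ → ℝ}
    (hb : IntegrableOn b (Ioi 0)) (hfb : ∀ t > 0, p (f t) ≤ b t) :
    p y ≤ ∫ t in Ioi 0, b t := by
  obtain ⟨g, hg, hgp⟩ := exists_functional_eq_seminorm p hp y
  have h1 : p y = ‖∫ t in Ioi 0, g (f t)‖ := by
    rw [(h g).2, hg, Complex.norm_real, Real.norm_of_nonneg (apply_nonneg p _)]
  rw [h1]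
  refine norm_integral_le_of_norm_le hb ?_
  filter_upwards [ae_restrict_mem measurableSet_Ioi] with t ht using (hgp _).trans (hfb t ht)

end HasWeakIntegral

/-- After multiplication by c this is the expectation of an affine function of an exponential time
of mean 1/c. -/
theorem integrableOn_and_integral_affine_mul_exp {c A B : ℝ} (hc : 0 < c) (hA : 0 ≤ A)
    (hB : 0 ≤ B) :
    IntegrableOn (fun s : ℝ => (A + B * s) * Real.exp (-c * s)) (Ioi 0) ∧
      ∫ s in Ioi 0, (A + B * s) * Real.exp (-c * s) = A / c + B / c ^ 2 := by
  set F : ℝ → ℝ := fun s => -(A / c + B / c ^ 2 + B / c * s) * Real.exp (-c * s)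
  have hF : ∀ s ∈ Ici (0 : ℝ), HasDerivAt F ((A + B * s) * Real.exp (-c * s)) s := by
    intro s _
    have h1 : HasDerivAt (fun s : ℝ => -(A / c + B / c ^ 2 + B / c * s)) (-(B / c * 1)) s :=
      (((hasDerivAt_id s).const_mul (B / c)).const_add _).neg
    have h2 : HasDerivAt (fun s : ℝ => Real.exp (-c * s)) (Real.exp (-c * s) * (-c * 1)) s :=
      ((hasDerivAt_id s).const_mul (-c)).exp
    refine (h1.mul h2).congr_deriv ?_
    field_simp
    ring
  have hpos : ∀ s ∈ Ioi (0 : ℝ), 0 ≤ (A + B * s) * Real.exp (-c * s) := fun s hs => by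
    have : 0 < s := hs
    positivity
  have hlim : Tendsto F atTop (𝓝 0) := by
    have h1 : Tendsto (fun s : ℝ => Real.exp (-c * s)) atTop (𝓝 0) :=
      Real.tendsto_exp_atBot.comp (tendsto_id.const_mul_atTop_of_neg (neg_lt_zero.2 hc))
    have h2 : Tendsto (fun s : ℝ => s * Real.exp (-c * s)) atTop (𝓝 0) := by
      simpa using tendsto_rpow_mul_exp_neg_mul_atTop_nhds_zero 1 c hc
    have h3 := (h1.const_mul (-(A / c + B / c ^ 2))).add (h2.const_mul (-(B / c)))
    simp only [mul_zero, add_zero] at h3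
    refine h3.congr fun s => ?_
    simp only [F]
    ring
  refine ⟨integrableOn_Ioi_deriv_of_nonneg' hF hpos hlim, ?_⟩
  rw [integral_Ioi_of_hasDerivAt_of_nonneg' hF hpos hlim]
  simp [F]

end WeakIntegral

/-! ### The resolvent as Laplace transform of the semigroup. -/

section Laplace

open MeasureTheory Set

variable {X : Type*} [AddCommGroup X] [Module ℂ X] [UniformSpace X]
  {nrm : Seminorm ℂ X} {T : ℝ≥0 → X →L[ℂ] X} {M ω : ℝ} {l : ℂ} {x y : X}

/-- The pair `(x, y)` belongs to the graph of the generator of `T`. -/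
def IsGeneratorPair (T : ℝ≥0 → X →L[ℂ] X) (x y : X) : Prop :=
  Tendsto (fun t : ℝ≥0 => ((t : ℝ) : ℂ)⁻¹ • (T t x - x)) (𝓝[>] 0) (𝓝 y)

/-- The integrand `e^{-l t} T(t) x` of the Laplace transform of an orbit. -/
noncomputable def laplaceIntegrand (T : ℝ≥0 → X →L[ℂ] X) (l : ℂ) (x : X) (t : ℝ) : X :=
  Complex.exp (-l * t) • T t.toNNReal x

theorem norm_cexp_neg_mul (l : ℂ) (t : ℝ) :
    ‖Complex.exp (-l * t)‖ = Real.exp (-l.re * t) := by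
  rw [Complex.norm_exp]
  simp

theorem seminorm_laplaceIntegrand (p : Seminorm ℂ X) (t : ℝ) :
    p (laplaceIntegrand T l x t) = Real.exp (-l.re * t) * p (T t.toNNReal x) := by
  rw [laplaceIntegrand, map_smul_eq_mul, norm_cexp_neg_mul]

theorem IsStronglyContinuousSemigroup.isGeneratorPair_map
    (hT : IsStronglyContinuousSemigroup T) (h : IsGeneratorPair T x y) (s : ℝ≥0) :
    IsGeneratorPair T (T s x) (T s y) := by
  refine (((T s).continuous.tendsto y).comp h).congr fun t => ?_
  have h1 : T t (T s x) = T s (T t x) := by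
    rw [← ContinuousLinearMap.comp_apply, ← hT.add, add_comm, hT.add,
      ContinuousLinearMap.comp_apply]
  simp only [Function.comp_apply, map_smul, map_sub, h1]

variable [ContinuousSMul ℂ X]

theorem IsStronglyContinuousSemigroup.continuous_laplaceIntegrand
    (hT : IsStronglyContinuousSemigroup T) : Continuous (laplaceIntegrand T l x) := by
  have h1 : Continuous fun s : ℝ => T s.toNNReal x :=
    (hT.continuous x).comp continuous_real_toNNReal
  have h2 : Continuous fun s : ℝ => Complex.exp (-l * s) := by fun_prop
  exact h2.smul h1

variable [IsUniformAddGroup X] [LocallyConvexSpace ℝ X]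

theorem IsStronglyContinuousSemigroup.exists_laplace (hX : IsTypeB nrm)
    (hT : IsStronglyContinuousSemigroup T) (hM : 0 ≤ M) (hTM : IsOfType nrm T M ω)
    (hl : ω < l.re) (x : X) : ∃ y, HasWeakIntegral (laplaceIntegrand T l x) y := by
  refine hX.exists_hasWeakIntegral hT.continuous_laplaceIntegrand (sub_pos.2 hl) fun p hp => ?_
  obtain ⟨c, hc, hcp⟩ := hX.exists_smul_mem p hp
  have hc' : (0 : ℝ) < c := hc
  refine ⟨M * nrm x / c, fun t ht => ?_⟩
  have h1 := hTM.apply_le hM hcp t.toNNReal x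
  rw [Real.coe_toNNReal t ht] at h1
  change Real.exp (-ω * t) * (c * p (T t.toNNReal x)) ≤ _ at h1
  rw [seminorm_laplaceIntegrand, div_mul_eq_mul_div, le_div_iff₀ hc']
  have h2 : Real.exp (-l.re * t) = Real.exp (-(l.re - ω) * t) * Real.exp (-ω * t) := by
    rw [← Real.exp_add]; ring_nf
  have h3 := mul_le_mul_of_nonneg_left h1 (Real.exp_pos (-(l.re - ω) * t)).le
  rw [h2]
  linarith

omit [IsUniformAddGroup X] [ContinuousSMul ℂ X] [LocallyConvexSpace ℝ X] in
-- T(h) shifts the integration variable by h, which produces the factor e^{lh} and removes the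
-- integral over (0, h).
theorem IsStronglyContinuousSemigroup.functional_apply_laplace
    (hT : IsStronglyContinuousSemigroup T)
    (hy : HasWeakIntegral (laplaceIntegrand T l x) y) (g : X →L[ℂ] ℂ) (h : ℝ≥0) :
    g (T h y) = Complex.exp (l * h) *
      (g y - ∫ s in 0..(h : ℝ), g (laplaceIntegrand T l x s)) := by
  have h1 : ∀ t ∈ Ioi (0 : ℝ), g (T h (laplaceIntegrand T l x t)) =
      Complex.exp (l * h) * g (laplaceIntegrand T l x (t + h)) := by
    intro t ht
    have ht' : (0 : ℝ) ≤ t := le_of_lt ht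
    have h2 : (t + h).toNNReal = h + t.toNNReal := by
      rw [Real.toNNReal_add ht' (NNReal.coe_nonneg h), add_comm, Real.toNNReal_coe]
    simp only [laplaceIntegrand, map_smul, smul_eq_mul, h2, hT.add,
      ContinuousLinearMap.comp_apply]
    rw [← mul_assoc, ← Complex.exp_add]
    push_cast
    ring_nf
  have h3 : ∫ t in Ioi (0 : ℝ), g (laplaceIntegrand T l x (t + h)) =
      ∫ t in Ioi (h : ℝ), g (laplaceIntegrand T l x t) := by
    have := (measurePreserving_add_right volume (h : ℝ)).setIntegral_preimage_emb
      (measurableEmbedding_addRight (h : ℝ)) (fun t => g (laplaceIntegrand T l x t)) (Ioi (h : ℝ))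
    simpa using this
  rw [← (hy.map (T h) g).2, setIntegral_congr_fun measurableSet_Ioi h1, integral_const_mul, h3,
    ← (hy g).2, ← intervalIntegral.integral_Ioi_sub_Ioi (hy g).1 (NNReal.coe_nonneg h), sub_sub_cancel]

/-- The difference T(h)y - e^{lh}y is -e^{lh} times the integral of e^{-ls}T(s)x over (0, h), whose
mean tends to x. The norming functional varies with h, so the integrand is estimated through p
itself, by joint continuity at (0, 0). -/
theorem IsStronglyContinuousSemigroup.tendsto_laplace_zero (hX : IsTypeB nrm)
    (hT : IsStronglyContinuousSemigroup T)
    (hy : HasWeakIntegral (laplaceIntegrand T l x) y) :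
    Tendsto (fun h : ℝ≥0 => ((h : ℝ) : ℂ)⁻¹ • (T h y - Complex.exp (l * h) • y) + x)
      (𝓝[>] 0) (𝓝 0) := by
  rw [hX.tendsto_zero_iff]
  intro p hp
  rw [tendsto_order]
  refine ⟨fun a ha => Eventually.of_forall fun i => ha.trans_le (apply_nonneg p _), fun ε hε => ?_⟩
  have hψ : Continuous fun z : ℝ × ℝ => p (x - Complex.exp (l * z.1) •
      laplaceIntegrand T l x z.2) := by
    have h1 : Continuous (laplaceIntegrand T l x) := hT.continuous_laplaceIntegrand
    have h2 : Continuous fun z : ℝ × ℝ => Complex.exp (l * z.1) := by fun_prop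
    exact hp.1.comp (continuous_const.sub (h2.smul (h1.comp continuous_snd)))
  have hψ0 : p (x - Complex.exp (l * (0 : ℝ)) • laplaceIntegrand T l x 0) < ε / 2 := by
    simpa [laplaceIntegrand, hT.zero] using hε
  obtain ⟨δ, hδ, hψδ⟩ := Metric.eventually_nhds_iff.1
    ((hψ.tendsto (0, 0)).eventually_lt_const hψ0)
  have hδ' : (0 : ℝ≥0) < δ.toNNReal := Real.toNNReal_pos.2 hδ
  filter_upwards [Ioo_mem_nhdsGT hδ'] with h hh
  have hpos : (0 : ℝ) < h := hh.1
  have hhδ : (h : ℝ) < δ := (Real.lt_toNNReal_iff_coe_lt).1 hh.2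
  obtain ⟨g, hg, hgp⟩ := exists_functional_eq_seminorm p hp.1
    (((h : ℝ) : ℂ)⁻¹ • (T h y - Complex.exp (l * h) • y) + x)
  have hcont : Continuous fun s => Complex.exp (l * h) * g (laplaceIntegrand T l x s) :=
    continuous_const.mul (g.continuous.comp hT.continuous_laplaceIntegrand)
  have h0 : ((h : ℝ) : ℂ) ≠ 0 := by exact_mod_cast hpos.ne'
  have h1 : g (((h : ℝ) : ℂ)⁻¹ • (T h y - Complex.exp (l * h) • y) + x) =
      ((h : ℝ) : ℂ)⁻¹ * ∫ s in 0..(h : ℝ),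
        (g x - Complex.exp (l * h) * g (laplaceIntegrand T l x s)) := by
    rw [intervalIntegral.integral_sub (by simp) (hcont.intervalIntegrable _ _),
      intervalIntegral.integral_const, intervalIntegral.integral_const_mul, map_add, map_smul,
      map_sub, hT.functional_apply_laplace hy, map_smul, sub_zero, Complex.real_smul]
    simp only [smul_eq_mul]
    field_simp
    ring
  have h2 : ‖∫ s in 0..(h : ℝ), (g x - Complex.exp (l * h) * g (laplaceIntegrand T l x s))‖ ≤
      ε / 2 * |(h : ℝ) - 0| := by
    refine intervalIntegral.norm_integral_le_of_norm_le_const fun s hs => ?_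
    rw [uIoc_of_le hpos.le] at hs
    have h3 : g x - Complex.exp (l * h) * g (laplaceIntegrand T l x s) =
        g (x - Complex.exp (l * h) • laplaceIntegrand T l x s) := by
      rw [map_sub, map_smul, smul_eq_mul]
    rw [h3]
    refine (hgp _).trans (le_of_lt (hψδ (y := ((h : ℝ), s)) ?_))
    rw [Prod.dist_eq, max_lt_iff]
    simp only [Real.dist_eq, sub_zero]
    exact ⟨by rwa [abs_of_pos hpos], by rw [abs_of_pos hs.1]; exact hs.2.trans_lt hhδ⟩
  have h4 : p (((h : ℝ) : ℂ)⁻¹ • (T h y - Complex.exp (l * h) • y) + x) =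
      ‖g (((h : ℝ) : ℂ)⁻¹ • (T h y - Complex.exp (l * h) • y) + x)‖ := by
    rw [hg, Complex.norm_real, Real.norm_of_nonneg (apply_nonneg p _)]
  rw [h4, h1, norm_mul, norm_inv, Complex.norm_real, Real.norm_of_nonneg hpos.le]
  rw [sub_zero, abs_of_pos hpos] at h2
  rw [inv_mul_lt_iff₀ hpos]
  nlinarith

theorem IsStronglyContinuousSemigroup.isGeneratorPair_laplace (hX : IsTypeB nrm)
    (hT : IsStronglyContinuousSemigroup T)
    (hy : HasWeakIntegral (laplaceIntegrand T l x) y) : IsGeneratorPair T y (l • y - x) := by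
  have h1 := hT.tendsto_laplace_zero hX hy
  have h2 : Tendsto (fun t : ℝ≥0 => ((t : ℝ) : ℂ)⁻¹ * (Complex.exp (l * t) - 1)) (𝓝[>] 0)
      (𝓝 l) := by
    have h4 : HasDerivAt (fun t : ℝ => Complex.exp (l * t)) (Complex.exp (l * (0 : ℝ)) * (l * 1))
        0 := by
      simpa using ((Complex.ofRealCLM.hasDerivAt (x := 0)).const_mul l).cexp
    have h5 := (hasDerivAt_iff_tendsto_slope.1 h4).comp
      (show Tendsto (fun t : ℝ≥0 => (t : ℝ)) (𝓝[>] 0) (𝓝[≠] 0) from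
        tendsto_nhdsWithin_iff.2 ⟨by
          simpa using (NNReal.continuous_coe.tendsto 0).mono_left nhdsWithin_le_nhds, by
          filter_upwards [self_mem_nhdsWithin] with t ht
          exact (NNReal.coe_pos.2 ht).ne'⟩)
    simpa [Function.comp_def, slope_def_module] using h5
  have h3 := (h1.add (h2.smul_const y)).sub_const x
  rw [zero_add] at h3
  refine h3.congr fun t => ?_
  module

/-- With y the Laplace transform of the orbit of x at l = ω + 1, x = ly - Ay is the limit of ly -
t⁻¹(T(t)y - y), and these vectors lie in the domain because the domain is invariant under T(t). -/
theorem IsStronglyContinuousSemigroup.dense_generator (hX : IsTypeB nrm)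
    (hT : IsStronglyContinuousSemigroup T) (hM : 0 ≤ M) (hTM : IsOfType nrm T M ω)
    {A : X →ₗ.[ℂ] X} (hA : IsGenerator T A) : Dense (A.domain : Set X) := by
  intro x
  obtain ⟨y, hy⟩ := hT.exists_laplace hX hM hTM (l := (ω + 1 : ℝ)) (by simp) x
  have hpair := hT.isGeneratorPair_laplace hX hy
  have hmem : ∀ t, T t y ∈ A.domain := fun t =>
    LinearPMap.mem_domain_of_mem_graph ((hA _ _).2 (hT.isGeneratorPair_map hpair t))
  have hmem0 : y ∈ A.domain := by simpa [hT.zero] using hmem 0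
  have h1 := hpair.const_sub (((ω + 1 : ℝ) : ℂ) • y)
  rw [sub_sub_cancel] at h1
  exact mem_closure_of_tendsto h1 (Eventually.of_forall fun t => A.domain.sub_mem
    (A.domain.smul_mem _ hmem0) (A.domain.smul_mem _ (A.domain.sub_mem (hmem t) hmem0)))

theorem IsStronglyContinuousSemigroup.mem_opResolventSet (hX : IsTypeB nrm)
    (hT : IsStronglyContinuousSemigroup T) (hM : 0 ≤ M) (hTM : IsOfType nrm T M ω)
    {A : X →ₗ.[ℂ] X} (hA : IsGenerator T A) (hl : ω < l.re) : l ∈ opResolventSet A := by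
  refine HilleYosida.mem_opResolventSet (fun x hx => ?_) fun x => ?_
  · exact hT.eq_zero_of_eigenvector hX hM hTM hl ((hA _ _).1 hx)
  · obtain ⟨y, hy⟩ := hT.exists_laplace hX hM hTM hl x
    exact ⟨y, (hA _ _).2 (hT.isGeneratorPair_laplace hX hy)⟩

/-- The resolvent of the generator is the Laplace transform of the semigroup. -/
theorem IsStronglyContinuousSemigroup.hasWeakIntegral_opResolvent (hX : IsTypeB nrm)
    (hT : IsStronglyContinuousSemigroup T) (hM : 0 ≤ M) (hTM : IsOfType nrm T M ω)
    {A : X →ₗ.[ℂ] X} (hA : IsGenerator T A) (hl : ω < l.re) (x : X) :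
    HasWeakIntegral (laplaceIntegrand T l x) (opResolvent A l x) := by
  obtain ⟨y, hy⟩ := hT.exists_laplace hX hM hTM hl x
  have h1 := opResolvent_smul_sub (hT.mem_opResolventSet hX hM hTM hA hl)
    ((hA _ _).2 (hT.isGeneratorPair_laplace hX hy))
  rw [sub_sub_cancel] at h1
  rwa [h1]

/-- Averaging over an exponential time of mean 1/(Re l - ω) shifts the argument of an affine
majorant by that mean and keeps its slope. Thus the bound has the same form again and can be
iterated. -/
theorem IsStronglyContinuousSemigroup.affine_bound_laplace
    (hT : IsStronglyContinuousSemigroup T) (hl : ω < l.re)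
    (hy : HasWeakIntegral (laplaceIntegrand T l x) y) {p : Seminorm ℂ X} (hp : Continuous p)
    {a b : ℝ} (hb : 0 ≤ b)
    (hab : ∀ t : ℝ≥0, Real.exp (-ω * t) * p (T t x) ≤ a + b * t) (t : ℝ≥0) :
    Real.exp (-ω * t) * p (T t (((l.re - ω : ℝ) : ℂ) • y)) ≤ a + b / (l.re - ω) + b * t := by
  set c := l.re - ω with hcdef
  have hc : 0 < c := sub_pos.2 hl
  have ha : 0 ≤ a := by
    have := hab 0
    rw [NNReal.coe_zero, mul_zero, mul_zero, add_zero] at this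
    exact (mul_nonneg (Real.exp_pos _).le (apply_nonneg p _)).trans this
  obtain ⟨hint, hval⟩ := integrableOn_and_integral_affine_mul_exp (A := a + b * t) hc
    (by positivity) hb
  have h1 : p (T t y) ≤ ∫ s in Ioi (0 : ℝ),
      Real.exp (ω * t) * ((a + b * t + b * s) * Real.exp (-c * s)) := by
    refine (hy.map (T t)).seminorm_le hp (hint.const_mul _) fun s hs => ?_
    have h2 : T t (laplaceIntegrand T l x s) =
        Complex.exp (-l * s) • T (t + s.toNNReal) x := by
      rw [laplaceIntegrand, map_smul, hT.add, ContinuousLinearMap.comp_apply]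
    have h3 := hab (t + s.toNNReal)
    rw [NNReal.coe_add, Real.coe_toNNReal s hs.le] at h3
    rw [h2, map_smul_eq_mul, norm_cexp_neg_mul]
    have h4 : Real.exp (-l.re * s) =
        (Real.exp (ω * t) * Real.exp (-c * s)) * Real.exp (-ω * (t + s)) := by
      rw [← Real.exp_add, ← Real.exp_add, hcdef]
      ring_nf
    rw [h4, mul_assoc]
    have h5 := mul_le_mul_of_nonneg_left h3
      (mul_pos (Real.exp_pos (ω * t)) (Real.exp_pos (-c * s))).le
    linarith
  rw [integral_const_mul, hval] at h1
  rw [map_smul, map_smul_eq_mul, Complex.norm_real, Real.norm_of_nonneg hc.le]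
  have h6 : Real.exp (-ω * t) * Real.exp (ω * t) = 1 := by
    rw [← Real.exp_add]; simp
  calc Real.exp (-ω * t) * (c * p (T t y))
      ≤ Real.exp (-ω * t) * (c * (Real.exp (ω * t) * ((a + b * t) / c + b / c ^ 2))) := by
        gcongr
    _ = (Real.exp (-ω * t) * Real.exp (ω * t)) * (a + b / c + b * t) := by
        field_simp
        ring
    _ = a + b / c + b * t := by rw [h6, one_mul]

theorem IsStronglyContinuousSemigroup.affine_bound_pow (hX : IsTypeB nrm)
    (hT : IsStronglyContinuousSemigroup T) (hM : 0 ≤ M) (hTM : IsOfType nrm T M ω)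
    {A : X →ₗ.[ℂ] X} (hA : IsGenerator T A) (hl : ω < l.re) {p : Seminorm ℂ X}
    (hp : Continuous p) {a b : ℝ} (hb : 0 ≤ b)
    (hab : ∀ t : ℝ≥0, Real.exp (-ω * t) * p (T t x) ≤ a + b * t) (n : ℕ) (t : ℝ≥0) :
    Real.exp (-ω * t) * p (T t (((((l.re - ω : ℝ) : ℂ) • opResolvent A l) ^ n) x)) ≤
      a + n * (b / (l.re - ω)) + b * t := by
  induction n generalizing t with
  | zero => simpa using hab t
  | succ n ih =>
    rw [pow_succ', Module.End.mul_apply, LinearMap.smul_apply]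
    refine (hT.affine_bound_laplace hl (hT.hasWeakIntegral_opResolvent hX hM hTM hA hl _) hp hb ih
      t).trans (le_of_eq ?_)
    push_cast
    ring

end Laplace

/-! ### Affine majorants from countable convexity, and the resolvent estimate. -/

section Majorant

/-- These telescoping weights have tail N/(N + n), whose reciprocal is affine in n; this is what
makes the majorant affine. -/
theorem hasSum_mul_inv_sub_inv_succ {N : ℕ} (hN : 0 < N) :
    HasSum (fun i : ℕ => (N : ℝ) * (((N : ℝ) + i)⁻¹ - ((N : ℝ) + i + 1)⁻¹)) 1 ∧
      (∀ i : ℕ, 0 ≤ (N : ℝ) * (((N : ℝ) + i)⁻¹ - ((N : ℝ) + i + 1)⁻¹)) ∧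
      ∀ n : ℕ, ∑ i ∈ Finset.range n, (N : ℝ) * (((N : ℝ) + i)⁻¹ - ((N : ℝ) + i + 1)⁻¹) =
        1 - N / (N + n) := by
  have hN' : (0 : ℝ) < N := by exact_mod_cast hN
  have hnonneg : ∀ i : ℕ, 0 ≤ (N : ℝ) * (((N : ℝ) + i)⁻¹ - ((N : ℝ) + i + 1)⁻¹) := fun i =>
    mul_nonneg hN'.le (sub_nonneg.2 (inv_anti₀ (by positivity) (by linarith)))
  have hsum : ∀ n : ℕ, ∑ i ∈ Finset.range n,
      (N : ℝ) * (((N : ℝ) + i)⁻¹ - ((N : ℝ) + i + 1)⁻¹) = 1 - N / (N + n) := by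
    intro n
    induction n with
    | zero => simp [hN'.ne']
    | succ n ih =>
      rw [Finset.sum_range_succ, ih]
      push_cast
      ring
  refine ⟨?_, hnonneg, hsum⟩
  rw [hasSum_iff_tendsto_nat_of_nonneg hnonneg]
  simp only [hsum]
  have h1 : Tendsto (fun n : ℕ => (N : ℝ) / (N + n)) atTop (𝓝 0) :=
    tendsto_const_nhds.div_atTop
      (tendsto_atTop_add_const_left _ _ tendsto_natCast_atTop_atTop)
  simpa using h1.const_sub 1

/-- A weighted average of an increasing sequence dominates an increasing affine function of the
index. -/
theorem mul_sub_le_of_hasSum {N : ℕ} (hN : 0 < N) {Q : ℕ → ℝ} (hQ : Monotone Q) {q : ℝ}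
    (hq : HasSum (fun i : ℕ => (N : ℝ) * (((N : ℝ) + i)⁻¹ - ((N : ℝ) + i + 1)⁻¹) *
      Q (N + i + 1)) q) (n : ℕ) :
    N * (Q (N + n + 1) - Q N) ≤ (q - Q N) * (N + n) := by
  obtain ⟨hα, hα0, hαn⟩ := hasSum_mul_inv_sub_inv_succ hN
  set α : ℕ → ℝ := fun i => (N : ℝ) * (((N : ℝ) + i)⁻¹ - ((N : ℝ) + i + 1)⁻¹)
  have hN' : (0 : ℝ) < N := by exact_mod_cast hN
  set K := Q (N + n + 1)
  -- Bound Q (N + i + 1) below by Q N for i < n and by K for i ≥ n: the weighted sum is then at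
  -- least K minus the first n weights times K - Q N.
  have h1 : HasSum (fun i => if i ∈ Finset.range n then α i * (K - Q N) else 0)
      (∑ i ∈ Finset.range n, α i * (K - Q N)) := by
    convert hasSum_sum_of_ne_finset_zero (s := Finset.range n)
      (f := fun i => if i ∈ Finset.range n then α i * (K - Q N) else 0) ?_ using 1
    · exact Finset.sum_congr rfl fun i hi => by rw [if_pos hi]
    · exact fun i hi => if_neg hi
    · infer_instance
  have h2 := hasSum_le (fun i => ?_) ((hα.mul_right K).sub h1) hq
  · rw [← Finset.sum_mul, hαn, one_mul] at h2
    have h3 : (N : ℝ) / (N + n) * (K - Q N) ≤ q - Q N := by linarith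
    rwa [div_mul_eq_mul_div, div_le_iff₀ (by positivity)] at h3
  · change α i * K - _ ≤ α i * Q (N + i + 1)
    split_ifs with hi
    · have : Q N ≤ Q (N + i + 1) := hQ (by omega)
      have := mul_le_mul_of_nonneg_left this (hα0 i)
      simp only [α] at this ⊢
      linarith
    · have hi' : n ≤ i := by simpa using hi
      have : K ≤ Q (N + i + 1) := hQ (by omega)
      have := mul_le_mul_of_nonneg_left this (hα0 i)
      simp only [α] at this ⊢
      linarith

variable {X : Type*} [AddCommGroup X] [Module ℂ X] [UniformSpace X]
  {nrm : Seminorm ℂ X} {T : ℝ≥0 → X →L[ℂ] X} {M ω : ℝ}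

/-- The rescaled orbits have an affine majorant in time whose value at `τ` is controlled by a
dominated seminorm. -/
theorem IsOfType.exists_affine_majorant (hX : IsTypeB nrm) (hM : 0 ≤ M)
    (hT : IsOfType nrm T M ω) {p : Seminorm ℂ X} (hp : p ∈ dominatedSeminorms nrm) (τ : ℝ) :
    ∃ q ∈ dominatedSeminorms nrm, ∀ x, ∃ a b : ℝ, 0 ≤ b ∧ a + b * τ ≤ M * q x ∧
      ∀ t : ℝ≥0, Real.exp (-ω * t) * p (T t x) ≤ a + b * t := by
  choose Q₀ hQ₀ hb₀ using fun m : ℕ => hT p hp m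
  -- Partial suprema make the seminorms increasing in the horizon, and they remain dominated by the
  -- norm.
  set Q := partialSups Q₀
  have hQ : ∀ m, Q m ∈ dominatedSeminorms nrm := by
    intro m
    induction m with
    | zero => simpa [Q] using hQ₀ 0
    | succ m ih =>
      simp only [Q]
      rw [partialSups_add_one]
      exact ⟨ih.1.sup (hQ₀ _).1, sup_le ih.2 (hQ₀ _).2⟩
  have hQm : ∀ x, Monotone fun m => Q m x := fun x m n hmn => (partialSups Q₀).monotone hmn x
  have hb : ∀ m : ℕ, ∀ x, ∀ t : ℝ≥0, t ≤ m → Real.exp (-ω * t) * p (T t x) ≤ M * Q m x :=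
    fun m x t ht => (hb₀ m x t ht).trans (by gcongr; exact le_partialSups Q₀ m x)
  -- The added 1 keeps N positive even when τ ≤ 0.
  set N := ⌈τ⌉₊ + 1 with hNdef
  have hN : 0 < N := Nat.succ_pos _
  have hN' : (0 : ℝ) < N := by exact_mod_cast hN
  have hτN : τ ≤ N := by
    rw [hNdef]; push_cast
    linarith [Nat.le_ceil τ]
  obtain ⟨hα, hα0, -⟩ := hasSum_mul_inv_sub_inv_succ hN
  obtain ⟨q, hq, hsum⟩ := hX.countablyConvex (fun i => Q (N + i + 1)) _ (fun i => hQ _) hα0 hα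
  refine ⟨q, hq, fun x => ?_⟩
  have key := mul_sub_le_of_hasSum hN (hQm x) (hsum x)
  have hge : Q N x ≤ q x := by
    have h1 := key 0
    have h2 : Q N x ≤ Q (N + 0 + 1) x := hQm x (by omega)
    have h3 : 0 ≤ (q x - Q N x) * (N + (0 : ℕ)) :=
      (mul_nonneg hN'.le (sub_nonneg.2 h2)).trans h1
    rw [Nat.cast_zero, add_zero] at h3
    exact sub_nonneg.1 (nonneg_of_mul_nonneg_left h3 hN')
  have hb0 : 0 ≤ M * (q x - Q N x) / N :=
    div_nonneg (mul_nonneg hM (sub_nonneg.2 hge)) hN'.le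
  -- The line through (0, M Q_N(x)) and (N, M q(x)): it covers t ≤ N by its intercept alone, and at
  -- τ ≤ N it is at most M q(x).
  refine ⟨M * Q N x, M * (q x - Q N x) / N, hb0, ?_, fun t => ?_⟩
  · calc M * Q N x + M * (q x - Q N x) / N * τ
        ≤ M * Q N x + M * (q x - Q N x) / N * N := by gcongr
      _ = M * q x := by field_simp; ring
  · rcases le_or_gt t N with ht | ht
    · have h1 := hb N x t ht
      have h2 : 0 ≤ M * (q x - Q N x) / N * t := mul_nonneg hb0 t.2
      linarith
    · obtain ⟨n, hn⟩ : ∃ n, ⌊t⌋₊ = N + n :=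
        Nat.exists_eq_add_of_le (Nat.le_floor ht.le)
      have h1 : t ≤ (N + n + 1 : ℕ) := by
        rw [← hn]; push_cast; exact (Nat.lt_floor_add_one t).le
      have h2 : ((N + n : ℕ) : ℝ≥0) ≤ t := by rw [← hn]; exact Nat.floor_le zero_le
      have h2' : (N : ℝ) + n ≤ t := by exact_mod_cast h2
      refine (hb _ x t h1).trans ?_
      have h3 := mul_le_mul_of_nonneg_left (key n) hM
      have h4 : M * (q x - Q N x) / N * (N + n) ≤ M * (q x - Q N x) / N * t := by gcongr
      have h5 : M * (Q (N + n + 1) x - Q N x) ≤ M * (q x - Q N x) / N * (N + n) := by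
        rw [div_mul_eq_mul_div, le_div_iff₀ hN']
        linarith
      linarith

variable [IsUniformAddGroup X] [ContinuousSMul ℂ X] [LocallyConvexSpace ℝ X]

/-- The n averages at ω + n(l - ω) have mean 1/(n(Re l - ω)) each, together 1/(Re l - ω) ≤ (l₀ -
ω)⁻¹. The majorant is therefore controlled at the single time (l₀ - ω)⁻¹, uniformly in n and l. -/
theorem IsStronglyContinuousSemigroup.resolvent_bound (hX : IsTypeB nrm)
    (hT : IsStronglyContinuousSemigroup T) (hM : 0 ≤ M) (hTM : IsOfType nrm T M ω)
    {A : X →ₗ.[ℂ] X} (hA : IsGenerator T A) {p : Seminorm ℂ X} (hp : p ∈ dominatedSeminorms nrm)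
    {l₀ : ℝ} (hl₀ : ω < l₀) :
    ∃ q ∈ dominatedSeminorms nrm, ∀ x : X, ∀ n : ℕ, 1 ≤ n → ∀ l : ℂ, l₀ ≤ l.re →
      p ((((n * (l.re - ω) : ℝ) : ℂ) • opResolvent A (ω + n * (l - ω))) ^ n <| x) ≤ M * q x := by
  obtain ⟨q, hq, hmaj⟩ := hTM.exists_affine_majorant hX hM hp (l₀ - ω)⁻¹
  refine ⟨q, hq, fun x n hn l hl => ?_⟩
  obtain ⟨a, b, hb, hab, hbound⟩ := hmaj x
  have hn' : (0 : ℝ) < n := by exact_mod_cast hn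
  have hlω : 0 < l.re - ω := by linarith
  have hre : ((ω : ℂ) + n * (l - ω)).re - ω = n * (l.re - ω) := by simp
  have h1 := hT.affine_bound_pow hX hM hTM hA (l := ω + n * (l - ω))
    (by rw [← sub_pos, hre]; positivity) hp.1 hb hbound n 0
  rw [hre] at h1
  simp only [NNReal.coe_zero, mul_zero, Real.exp_zero, one_mul, add_zero, hT.zero,
    ContinuousLinearMap.id_apply] at h1
  refine h1.trans (le_trans ?_ hab)
  have h2 : (n : ℝ) * (b / (n * (l.re - ω))) = b * (l.re - ω)⁻¹ := by field_simp
  rw [h2]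
  gcongr

/-- The graph is the set where R(l)(lx - y) = x, and R(l) is continuous by the case n = 1 of the
resolvent estimate at l = ω + 1. -/
theorem IsStronglyContinuousSemigroup.isClosed_generator (hX : IsTypeB nrm)
    (hT : IsStronglyContinuousSemigroup T) (hM : 0 ≤ M) (hTM : IsOfType nrm T M ω)
    {A : X →ₗ.[ℂ] X} (hA : IsGenerator T A) : A.IsClosed := by
  have := hX.t2Space
  have hl : ω < ((ω + 1 : ℝ) : ℂ).re := by simp
  have hρ := hT.mem_opResolventSet hX hM hTM hA hl
  set l : ℂ := ((ω + 1 : ℝ) : ℂ) with hldef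
  have hc : Continuous (opResolvent A l) := by
    refine hX.continuous_of_bound _ M fun p hp => ?_
    obtain ⟨q, hq, hb⟩ := hT.resolvent_bound hX hM hTM hA hp (l₀ := ω + 1) (by linarith)
    refine ⟨q, hq, fun x => ?_⟩
    simpa [hldef] using hb x 1 le_rfl l (by simp [hldef])
  have hgraph : (A.graph : Set (X × X)) =
      {z | opResolvent A l (l • z.1 - z.2) = z.1} := by
    ext ⟨x, y⟩
    refine ⟨fun h => opResolvent_smul_sub hρ h, fun h => ?_⟩
    have h1 := opResolvent_mem_graph hρ (l • x - y)
    have h2 : opResolvent A l (l • x - y) = x := h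
    rw [h2, sub_sub_cancel] at h1
    exact h1
  rw [LinearPMap.IsClosed, hgraph]
  exact isClosed_eq (hc.comp ((continuous_fst.const_smul l).sub continuous_snd)) continuous_fst

end Majorant

end HilleYosida

/-! ### The equivalence, closed as the cycle (a) → (c) → (b) → (a). -/

open HilleYosida in
theorem mainTheorem1 {X : Type*} [AddCommGroup X] [Module ℂ X] [UniformSpace X]
    [IsUniformAddGroup X] [ContinuousSMul ℂ X] [LocallyConvexSpace ℝ X]
    (nrm : Seminorm ℂ X) (hX : IsTypeB nrm) (A : X →ₗ.[ℂ] X)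
    (M ω : ℝ) (hM : 1 ≤ M) :
    List.TFAE [
      ∃ T : ℝ≥0 → X →L[ℂ] X,
        IsStronglyContinuousSemigroup T ∧ IsOfType nrm T M ω ∧ IsGenerator T A,
      A.IsClosed ∧ Dense (A.domain : Set X) ∧
        (∀ l : ℝ, ω < l → (l : ℂ) ∈ opResolventSet A) ∧
        ∀ p ∈ dominatedSeminorms nrm, ∀ l₀ : ℝ, ω < l₀ → ∃ q ∈ dominatedSeminorms nrm,
          ∀ x : X, ∀ n : ℕ, 1 ≤ n → ∀ l : ℝ, l₀ ≤ l →
            p ((((n * (l - ω) : ℝ) : ℂ) • opResolvent A ((ω + n * (l - ω) : ℝ) : ℂ)) ^ n <| x)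
              ≤ M * q x,
      A.IsClosed ∧ Dense (A.domain : Set X) ∧
        (∀ l : ℂ, ω < l.re → l ∈ opResolventSet A) ∧
        ∀ p ∈ dominatedSeminorms nrm, ∀ l₀ : ℝ, ω < l₀ → ∃ q ∈ dominatedSeminorms nrm,
          ∀ x : X, ∀ n : ℕ, 1 ≤ n → ∀ l : ℂ, l₀ ≤ l.re →
            p ((((n * (l.re - ω) : ℝ) : ℂ) • opResolvent A (ω + n * (l - ω))) ^ n <| x)
              ≤ M * q x] := by
  have hM0 : 0 ≤ M := zero_le_one.trans hM
  tfae_have 1 → 3 := by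
    rintro ⟨T, hT, hTM, hA⟩
    exact ⟨hT.isClosed_generator hX hM0 hTM hA, hT.dense_generator hX hM0 hTM hA,
      fun l hl => hT.mem_opResolventSet hX hM0 hTM hA hl,
      fun p hp l₀ hl₀ => hT.resolvent_bound hX hM0 hTM hA hp hl₀⟩
  tfae_have 3 → 2 := by
    rintro ⟨hc, hd, hρ, hb⟩
    refine ⟨hc, hd, fun l hl => hρ l (by simpa using hl), fun p hp l₀ hl₀ => ?_⟩
    obtain ⟨q, hq, h⟩ := hb p hp l₀ hl₀
    refine ⟨q, hq, fun x n hn l hl => ?_⟩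
    have h1 := h x n hn (l : ℂ) (by simpa using hl)
    have h2 : ((ω + n * (l - ω) : ℝ) : ℂ) = ω + n * ((l : ℂ) - ω) := by push_cast; rfl
    rw [h2]
    rwa [Complex.ofReal_re] at h1
  tfae_have 2 → 1 := by
    rintro ⟨-, hd, hρ, hb⟩
    exact exists_semigroup_of_resolvent hX hM hd hρ hb
  tfae_finish
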